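/- Let $\rho,\mu_1,\mu_2:\mathbb{R}\to(0,\infty)$ be $1$-periodic, strictly positive, piecewise continuous functions (finite one-sided limits everywhere, finitely many discontinuities per period), with $\mu_1$ bounded below by a positive constant. For $\omega^2,k^2\in\mathbb{C}$ (regarded as two independent complex variables) put $$\mathbf{Q}(y)=i\begin{pmatrix}0&-\mu_1(y)^{-1}\\ \mu_2(y)k^2-\rho(y)\omega^2&0\end{pmatrix},$$ let $$\mathbf{M}(y,y_0)=\begin{pmatrix}M_1&M_2\\M_3&M_4\end{pmatrix}(y,y_0)=\mathbf{I}+\int_{y_0}^{y}\mathbf{Q}(\varsigma_1)\,d\varsigma_1+\int_{y_0}^{y}\mathbf{Q}(\varsigma_1)\,d\varsigma_1\int_{y_0}^{\varsigma_1}\mathbf{Q}(\varsigma_2)\,d\varsigma_2+\cdots$$ be the matricant (Peano series) of $\eta'=\mathbf{Q}\eta$, define $m_2$ by $i\,m_2(y)=M_2(y+1,y)$, and let $\Delta(\omega^2,k^2)=\tfrac12\operatorname{tr}\mathbf{M}(1,0)$ be the Lyapunov function. **Theorem.** The Peano series converges absolutely, $\Delta$ is analytic on $\mathbb{C}^2$,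 and for all $\omega^2,k^2\in\mathbb{C}$ and all integers $n,m\ge 0$ with $n+m\ge 1$, $$\frac{\partial^{n+m}\Delta(\omega^2,k^2)}{\partial(\omega^2)^n\,\partial(k^2)^m}=\frac12(-i)^n i^m\,n!\,m!\int_0^1 d\varsigma_1\int_0^{\varsigma_1}d\varsigma_2\cdots\int_0^{\varsigma_{n+m-1}}d\varsigma_{n+m}\;F(\varsigma_1,\dots,\varsigma_{n+m})\,M_2(\varsigma_{n+m}+1,\varsigma_1)\,M_2(\varsigma_1,\varsigma_2)\cdots M_2(\varsigma_{n+m-1},\varsigma_{n+m}),$$ where the integrand is integrable on the simplex $1\ge\varsigma_1\ge\cdots\ge\varsigma_{n+m}\ge0$ and $$F(\varsigma_1,\dots,\varsigma_{n+m})=\sum_{\substack{\sigma\in\{0,1\}^{n+m}\\ \sigma_1+\cdots+\sigma_{n+m}=m}}f_{\sigma_1}(\varsigma_1)\cdots f_{\sigma_{n+m}}(\varsigma_{n+m}),\qquad f_0=\rho,\quad f_1=\mu_2.$$ (For $n+m=1$ the product of $M_2$'s is the single factor $M_2(\varsigma_1+1,\varsigma_1)$.) In particular, $$\frac{\partial\Delta}{\partial(\omega^2)}=\frac12\int_0^1\rho(y)\,m_2(y)\,dy,\qquad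 \frac{\partial\Delta}{\partial(k^2)}=-\frac12\int_0^1\mu_2(y)\,m_2(y)\,dy,$$ with integrable integrands. -/

import Mathlib

open Filter Topology MeasureTheory

noncomputable section

/-- A real function on the line is piecewise continuous: it has finite one-sided limits everywhere
and finitely many discontinuities in every compact interval. -/
structure PiecewiseContinuous (f : ℝ → ℝ) : Prop where
  exists_left_limit : ∀ y, ∃ l, Tendsto f (𝓝[<] y) (𝓝 l)
  exists_right_limit : ∀ y, ∃ l, Tendsto f (𝓝[>] y) (𝓝 l)
  finite_discontinuities : ∀ a b, {y ∈ Set.Icc a b | ¬ ContinuousAt f y}.Finite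

/-- A material coefficient: 1-periodic, strictly positive and piecewise continuous. -/
structure IsMaterialCoefficient (f : ℝ → ℝ) : Prop where
  periodic : Function.Periodic f 1
  pos : ∀ y, 0 < f y
  piecewiseContinuous : PiecewiseContinuous f

/-- The terms of the Peano series of `η' = Q η` based at `y₀`:
`P₀(y) = I` and `Pₙ₊₁(y) = ∫_{y₀}^{y} Q(s) Pₙ(s) ds`, the integral being taken entrywise. -/
def peanoTerm (Q : ℝ → Matrix (Fin 2) (Fin 2) ℂ) (y₀ : ℝ) :
    ℕ → ℝ → Matrix (Fin 2) (Fin 2) ℂ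
  | 0, _ => 1
  | n + 1, y => Matrix.of fun i j => ∫ s in y₀..y, (Q s * peanoTerm Q y₀ n s) i j

/-- The matricant (multiplicative integral) `M(y, y₀)` of `η' = Q η`: the sum of the Peano
series, taken entrywise. -/
def matricant (Q : ℝ → Matrix (Fin 2) (Fin 2) ℂ) (y y₀ : ℝ) : Matrix (Fin 2) (Fin 2) ℂ :=
  Matrix.of fun i j => ∑' n, peanoTerm Q y₀ n y i j

/-- The matrix `Q(y)` of the first-order system for `η = (u, i μ₁ u')`, equivalent to
`(μ₁ u')' - k² μ₂ u = -ω² ρ u`. The arguments `w` and `κ` stand for `ω²` and `k²`. -/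
def systemMatrix (ρ μ₁ μ₂ : ℝ → ℝ) (w κ : ℂ) (y : ℝ) : Matrix (Fin 2) (Fin 2) ℂ :=
  Complex.I • !![0, -(μ₁ y : ℂ)⁻¹; (μ₂ y : ℂ) * κ - (ρ y : ℂ) * w, 0]

/-- The Lyapunov function `Δ(ω², k²) = ½ tr M(1, 0)`, with `w = ω²` and `κ = k²`. -/
def lyapunov (ρ μ₁ μ₂ : ℝ → ℝ) (w κ : ℂ) : ℂ :=
  1 / 2 * (matricant (systemMatrix ρ μ₁ μ₂ w κ) 1 0).trace

/-- The right off-diagonal entry `M₂(y, y₀)` of the matricant. -/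
def matricantM₂ (ρ μ₁ μ₂ : ℝ → ℝ) (w κ : ℂ) (y y₀ : ℝ) : ℂ :=
  matricant (systemMatrix ρ μ₁ μ₂ w κ) y y₀ 0 1

/-- The function `m₂` with `i m₂(y) = M₂(y + 1, y)`. -/
def monodromym₂ (ρ μ₁ μ₂ : ℝ → ℝ) (w κ : ℂ) (y : ℝ) : ℂ :=
  matricantM₂ ρ μ₁ μ₂ w κ (y + 1) y / Complex.I

/-- The weight `F(ς₁, …, ς_{n+m})`: the sum over all `σ ∈ {0,1}^{n+m}` with `∑ σᵢ = m` of the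
products of the `f_{σᵢ}(ςᵢ)`, where `f₀ = ρ` and `f₁ = μ₂`. -/
def symmetrizedWeight (ρ μ₂ : ℝ → ℝ) (n m : ℕ) (ς : Fin (n + m) → ℝ) : ℝ :=
  ∑ σ : Fin (n + m) → Fin 2 with ∑ i, (σ i : ℕ) = m, ∏ i, ![ρ, μ₂] (σ i) (ς i)

/-- The cyclic product `K(ς_N + 1, ς₁) K(ς₁, ς₂) ⋯ K(ς_{N-1}, ς_N)` for `N ≥ 1`; the value for
`N = 0` is a convention that is never used. -/
def cyclicProduct (K : ℝ → ℝ → ℂ) : (N : ℕ) → (Fin N → ℝ) → ℂ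
  | 0, _ => 1
  | N + 1, ς => K (ς (Fin.last N) + 1) (ς 0) * ∏ i : Fin N, K (ς i.castSucc) (ς i.succ)

/-- The integrand of the formula for the derivative of order `n` in `ω²` and `m` in `k²`. -/
def derivIntegrand (ρ μ₁ μ₂ : ℝ → ℝ) (w κ : ℂ) (n m : ℕ) (ς : Fin (n + m) → ℝ) : ℂ :=
  (symmetrizedWeight ρ μ₂ n m ς : ℂ) * cyclicProduct (matricantM₂ ρ μ₁ μ₂ w κ) (n + m) ς

/-- The iterated integral `∫_0^b dς₁ ∫_0^{ς₁} dς₂ ⋯ ∫_0^{ς_{N-1}} dς_N g(ς₁, …, ς_N)`. -/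
def iteratedSimplexIntegral : (N : ℕ) → ℝ → ((Fin N → ℝ) → ℂ) → ℂ
  | 0, _, g => g ![]
  | N + 1, b, g => ∫ s in (0 : ℝ)..b, iteratedSimplexIntegral N s fun t => g (Fin.cons s t)

/-- The ordered simplex `1 ≥ ς₁ ≥ ς₂ ≥ ⋯ ≥ ς_N ≥ 0`. -/
def orderedSimplex (N : ℕ) : Set (Fin N → ℝ) :=
  {ς | (∀ i, ς i ∈ Set.Icc (0 : ℝ) 1) ∧ Antitone ς}

end

/-! The spectral parameters enter $\mathbf Q$ only through its lower left entry. Moving them by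
$(x,y)$ therefore adds $g\,E_{21}$, where $g=-ix\rho+iy\mu_2$. Iterating variation of constants
expands the perturbed matricant at $(1,0)$ into the Dyson series, whose $N$-th term integrates
$\mathbf M(1,t_1)\,gE_{21}\,\mathbf M(t_1,t_2)\,gE_{21}\cdots gE_{21}\,\mathbf M(t_N,0)$ over the
ordered simplex (`tendsto_sum_iterate_duhamel`, `map_iterate_duhamel`).

Since $E_{21}XE_{21}=X_{12}E_{21}$, each inner matricant collapses to the scalar $M_2(t_i,t_{i+1})$.
The trace closes the chain into a cycle: it leaves the upper right entry of $\mathbf M(t_N,0)\mathbf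
M(1,t_1)$, and periodicity with the cocycle identity turns this product into $\mathbf M(t_N+1,t_1)$
(`trace_dysonIntegrand`).

Expanding $\prod_i g(t_i)$ in powers of $x$ and $y$ produces the weights $F$
(`prod_eq_sum_degreeWeight`). The simplex has volume $1/N!$, so the coefficients of total degree $N$
are at most $KA^N/N!$. Hence $\Delta$ is an everywhere convergent double power series about every
point (`hasSum_lyapunovCoeff`); analyticity and all partial derivatives are read off from it. -/

/-! ### Locally bounded functions with countably many discontinuities -/

/-- A function continuous off `S` and bounded on bounded sets. -/
structure RegulatedOff {E : Type*} [NormedAddCommGroup E] (S : Set ℝ) (f : ℝ → E) : Prop where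
  continuousAt : ∀ y ∉ S, ContinuousAt f y
  bounded : ∀ R : ℝ, ∃ C : ℝ, 0 ≤ C ∧ ∀ y, |y| ≤ R → ‖f y‖ ≤ C

namespace RegulatedOff

section Space

variable {E : Type*} [NormedAddCommGroup E] {S : Set ℝ} {f g : ℝ → E}

lemma of_continuous (hf : Continuous f) : RegulatedOff S f where
  continuousAt y _ := hf.continuousAt
  bounded R := by
    obtain ⟨C, hC⟩ := (isCompact_Icc (a := -R) (b := R)).exists_bound_of_continuousOn
      hf.continuousOn
    exact ⟨max C 0, le_max_right _ _, fun y hy => (hC y (abs_le.mp hy)).trans (le_max_left _ _)⟩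

lemma add (hf : RegulatedOff S f) (hg : RegulatedOff S g) :
    RegulatedOff S fun y => f y + g y where
  continuousAt y hy := (hf.continuousAt y hy).add (hg.continuousAt y hy)
  bounded R := by
    obtain ⟨C, hC0, hC⟩ := hf.bounded R
    obtain ⟨D, hD0, hD⟩ := hg.bounded R
    exact ⟨C + D, by positivity,
      fun y hy => (norm_add_le _ _).trans (add_le_add (hC y hy) (hD y hy))⟩

lemma aestronglyMeasurable (hS : S.Countable) (hf : RegulatedOff S f) :
    AEStronglyMeasurable f volume := by
  have h1 : AEStronglyMeasurable f (volume.restrict Sᶜ) :=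
    ContinuousOn.aestronglyMeasurable
      (fun y hy => (hf.continuousAt y hy).continuousWithinAt) hS.measurableSet.compl
  have h2 : volume.restrict Sᶜ = (volume : Measure ℝ) := by
    apply Measure.restrict_eq_self_of_ae_mem
    exact hS.ae_notMem _
  rwa [h2] at h1

lemma intervalIntegrable (hS : S.Countable) (hf : RegulatedOff S f) (a b : ℝ) :
    IntervalIntegrable f volume a b := by
  obtain ⟨C, -, hC⟩ := hf.bounded (max |a| |b|)
  refine (intervalIntegrable_const (c := C)).mono_fun
    (hf.aestronglyMeasurable hS).restrict ?_
  refine (ae_restrict_mem measurableSet_uIoc).mono fun y hy => ?_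
  refine (hC y ?_).trans (le_abs_self C)
  rcases Set.mem_uIoc.mp hy with h | h
  · exact abs_le_max_abs_abs h.1.le h.2
  · rw [max_comm]; exact abs_le_max_abs_abs h.1.le h.2

variable [NormedSpace ℝ E]

lemma continuous_integral (hS : S.Countable) (hf : RegulatedOff S f) (a : ℝ) :
    Continuous fun y => ∫ s in a..y, f s :=
  intervalIntegral.continuous_primitive (hf.intervalIntegrable hS) a

lemma hasDerivAt_integral [CompleteSpace E] (hS : S.Countable) (hf : RegulatedOff S f) (a : ℝ) {y : ℝ} (hy : y ∉ S) :
    HasDerivAt (fun y => ∫ s in a..y, f s) (f y) y :=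
  intervalIntegral.integral_hasDerivAt_right (hf.intervalIntegrable hS a y)
    (hf.aestronglyMeasurable hS).stronglyMeasurableAtFilter (hf.continuousAt y hy)

end Space

lemma mul {𝔸 : Type*} [NormedRing 𝔸] {S : Set ℝ} {f g : ℝ → 𝔸} (hf : RegulatedOff S f)
    (hg : RegulatedOff S g) : RegulatedOff S fun y => f y * g y where
  continuousAt y hy := (hf.continuousAt y hy).mul (hg.continuousAt y hy)
  bounded R := by
    obtain ⟨C, hC0, hC⟩ := hf.bounded R
    obtain ⟨D, hD0, hD⟩ := hg.bounded R
    exact ⟨C * D, by positivity, fun y hy => (norm_mul_le _ _).trans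
      (mul_le_mul (hC y hy) (hD y hy) (norm_nonneg _) hC0)⟩

end RegulatedOff

/-- The common induction step of all factorial bounds: Peano terms, uniqueness, the Dyson remainder
and simplex integrals. -/
lemma norm_integral_le_pow_div_factorial {E : Type*} [NormedAddCommGroup E] [NormedSpace ℝ E]
    {h : ℝ → E} {a y K C : ℝ} {n : ℕ}
    (hh : ∀ s ∈ Set.uIcc a y, ‖h s‖ ≤ C * (K * (C * |s - a|) ^ n / n.factorial)) :
    ‖∫ s in a..y, h s‖ ≤ K * (C * |y - a|) ^ (n + 1) / (n + 1).factorial := by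
  rw [intervalIntegral.norm_intervalIntegral_eq]
  have hcont : Continuous fun s : ℝ => C * (K * (C * |s - a|) ^ n / n.factorial) := by fun_prop
  refine (norm_integral_le_of_norm_le (g := fun s => C * (K * (C * |s - a|) ^ n / n.factorial))
    (hcont.integrableOn_uIcc.mono_set Set.uIoc_subset_uIcc) ?_).trans (le_of_eq ?_)
  · exact (ae_restrict_mem measurableSet_uIoc).mono
      fun s hs => hh s (Set.uIoc_subset_uIcc hs)
  · have : (fun s : ℝ => C * (K * (C * |s - a|) ^ n / n.factorial)) =
        fun s => (K * C ^ (n + 1) / n.factorial) * |s - a| ^ n := by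
      funext s; rw [mul_pow]; ring
    rw [this, integral_const_mul, integral_pow_abs_sub_uIoc, Nat.factorial_succ]
    push_cast
    rw [mul_pow]
    field_simp

lemma tendsto_const_mul_pow_div_factorial (K x : ℝ) :
    Tendsto (fun n : ℕ => K * x ^ n / n.factorial) atTop (𝓝 0) := by
  simpa [mul_div_assoc] using (FloorSemiring.tendsto_pow_div_factorial_atTop x).const_mul K

/-! ### Peano series, Cauchy problem and cocycle identity -/

section Propagator

variable {𝔸 : Type*} [NormedRing 𝔸] [NormedAlgebra ℝ 𝔸]

/-- The terms of the Peano series of `u' = Q u` in a normed algebra. -/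
noncomputable def picardTerm (Q : ℝ → 𝔸) (a : ℝ) : ℕ → ℝ → 𝔸
  | 0, _ => 1
  | n + 1, y => ∫ s in a..y, Q s * picardTerm Q a n s

/-- The fundamental solution of `u' = Q u` normalized at `a`. -/
noncomputable def propagator (Q : ℝ → 𝔸) (y a : ℝ) : 𝔸 := ∑' n, picardTerm Q a n y

lemma picardTerm_add_one {Q : ℝ → 𝔸} (hper : Function.Periodic Q 1) (a : ℝ) (n : ℕ) (y : ℝ) :
    picardTerm Q (a + 1) n (y + 1) = picardTerm Q a n y := by
  induction n generalizing y with
  | zero => rfl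
  | succ n ih =>
    simp only [picardTerm]
    rw [← intervalIntegral.integral_comp_add_right _ (1 : ℝ)]
    simp only [ih, hper _]

lemma propagator_add_one {Q : ℝ → 𝔸} (hper : Function.Periodic Q 1) (y a : ℝ) :
    propagator Q (y + 1) (a + 1) = propagator Q y a := by
  simp only [propagator, picardTerm_add_one hper]

variable [NormOneClass 𝔸]

lemma norm_picardTerm_le {Q : ℝ → 𝔸} {C : ℝ} (hQ : ∀ y, ‖Q y‖ ≤ C) (a : ℝ) (n : ℕ) (y : ℝ) :
    ‖picardTerm Q a n y‖ ≤ (C * |y - a|) ^ n / n.factorial := by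
  have hC : 0 ≤ C := (norm_nonneg _).trans (hQ 0)
  induction n generalizing y with
  | zero => simp [picardTerm]
  | succ n ih =>
    simpa [picardTerm] using norm_integral_le_pow_div_factorial (K := 1) (n := n) (a := a) (y := y)
      (h := fun s => Q s * picardTerm Q a n s) (C := C) fun s _ => (norm_mul_le _ _).trans <| by
        rw [one_mul]; exact mul_le_mul (hQ s) (ih s) (norm_nonneg _) hC

lemma summable_norm_picardTerm {Q : ℝ → 𝔸} {C : ℝ} (hQ : ∀ y, ‖Q y‖ ≤ C) (a y : ℝ) :
    Summable fun n => ‖picardTerm Q a n y‖ :=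
  Summable.of_nonneg_of_le (fun _ => norm_nonneg _) (fun n => norm_picardTerm_le hQ a n y)
    (Real.summable_pow_div_factorial _)

lemma norm_propagator_le {Q : ℝ → 𝔸} {C : ℝ} (hQ : ∀ y, ‖Q y‖ ≤ C) (y a : ℝ) :
    ‖propagator Q y a‖ ≤ Real.exp (C * |y - a|) := by
  refine (norm_tsum_le_tsum_norm (summable_norm_picardTerm hQ a y)).trans ?_
  rw [Real.exp_eq_exp_ℝ, NormedSpace.exp_eq_tsum_div]
  exact (summable_norm_picardTerm hQ a y).tsum_le_tsum (fun n => norm_picardTerm_le hQ a n y)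
    (Real.summable_pow_div_factorial _)

variable [CompleteSpace 𝔸]

lemma hasSum_picardTerm {Q : ℝ → 𝔸} {C : ℝ} (hQ : ∀ y, ‖Q y‖ ≤ C) (a y : ℝ) :
    HasSum (fun n => picardTerm Q a n y) (propagator Q y a) :=
  (summable_norm_picardTerm hQ a y).of_norm.hasSum

variable {S : Set ℝ} (hS : S.Countable) {Q : ℝ → 𝔸} (hQr : RegulatedOff S Q) {C : ℝ}
  (hQ : ∀ y, ‖Q y‖ ≤ C)

omit [NormOneClass 𝔸] [CompleteSpace 𝔸] in
include hS hQr in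
lemma continuous_picardTerm (a : ℝ) (n : ℕ) : Continuous (picardTerm Q a n) := by
  induction n with
  | zero => exact continuous_const
  | succ n ih => exact (hQr.mul (RegulatedOff.of_continuous ih)).continuous_integral hS a

include hS hQr hQ

lemma continuous_propagator_left (a : ℝ) : Continuous fun y => propagator Q y a := by
  refine continuous_iff_continuousAt.mpr fun y₀ => ?_
  have hC : 0 ≤ C := (norm_nonneg _).trans (hQ 0)
  have : ContinuousOn (fun y => propagator Q y a) (Metric.ball y₀ 1) := by
    have hsum : Summable fun n : ℕ => (C * (|y₀ - a| + 1)) ^ n / n.factorial :=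
      Real.summable_pow_div_factorial _
    unfold propagator
    apply continuousOn_tsum (fun n => (continuous_picardTerm hS hQr a n).continuousOn) hsum
    intro n y hy
    refine (norm_picardTerm_le hQ a n y).trans ?_
    have : |y - a| ≤ |y₀ - a| + 1 := by
      have h1 : |y - y₀| < 1 := hy
      have h2 := abs_sub_le y y₀ a
      linarith
    gcongr
  exact this.continuousAt (Metric.ball_mem_nhds y₀ one_pos)

/-- The recursion of the Peano terms is summed under the integral by dominated convergence. -/
lemma propagator_eq_one_add_integral (y a : ℝ) :
    propagator Q y a = 1 + ∫ s in a..y, Q s * propagator Q s a := by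
  have hC : 0 ≤ C := (norm_nonneg _).trans (hQ 0)
  have hint : HasSum (fun n => ∫ s in a..y, Q s * picardTerm Q a n s)
      (∫ s in a..y, Q s * propagator Q s a) := by
    refine intervalIntegral.hasSum_integral_of_dominated_convergence
      (fun n _ => C * ((C * |y - a|) ^ n / n.factorial)) (fun n => ?_) (fun n => ?_) ?_ ?_ ?_
    · exact ((hQr.mul (.of_continuous
        (continuous_picardTerm hS hQr a n))).aestronglyMeasurable hS).restrict
    · refine Eventually.of_forall fun s hs => (norm_mul_le _ _).trans
        (mul_le_mul (hQ s) ((norm_picardTerm_le hQ a n s).trans ?_) (norm_nonneg _) hC)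
      have : |s - a| ≤ |y - a| := Set.abs_sub_left_of_mem_uIcc (Set.uIoc_subset_uIcc hs)
      gcongr
    · exact Eventually.of_forall fun s _ => (Real.summable_pow_div_factorial _).mul_left C
    · exact intervalIntegrable_const
    · exact Eventually.of_forall fun s _ => (hasSum_picardTerm hQ a s).mul_left (Q s)
  have h := (hasSum_nat_add_iff' 1).mpr (hasSum_picardTerm hQ a y)
  simp only [Finset.sum_range_one, picardTerm] at h
  rw [← h.unique hint]; simp

lemma propagator_self (a : ℝ) : propagator Q a a = 1 := by
  rw [propagator_eq_one_add_integral hS hQr hQ]; simp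

lemma hasDerivAt_propagator (a : ℝ) {y : ℝ} (hy : y ∉ S) :
    HasDerivAt (fun y => propagator Q y a) (Q y * propagator Q y a) y := by
  have h := ((hQr.mul (.of_continuous
    (continuous_propagator_left hS hQr hQ a))).hasDerivAt_integral hS a hy).const_add 1
  exact h.congr_of_eventuallyEq (Eventually.of_forall
    fun y => propagator_eq_one_add_integral hS hQr hQ y a)

omit [NormOneClass 𝔸] in
/-- Uniqueness for the linear Cauchy problem `u' = Q u`, `u(a) = 0`. -/
lemma eq_zero_of_hasDerivAt_off_countable {u : ℝ → 𝔸} (hu : Continuous u) {a : ℝ} (ha : u a = 0)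
    (hd : ∀ y ∉ S, HasDerivAt u (Q y * u y) y) (y : ℝ) : u y = 0 := by
  have hC : 0 ≤ C := (norm_nonneg _).trans (hQ 0)
  have hint : ∀ z, u z = ∫ s in a..z, Q s * u s := fun z => by
    rw [MeasureTheory.integral_eq_of_hasDerivAt_off_countable u _ hS hu.continuousOn
      (fun x hx => hd x hx.2) ((hQr.mul (.of_continuous hu)).intervalIntegrable hS a z), ha,
      sub_zero]
  obtain ⟨K, hK⟩ := (isCompact_uIcc (a := a) (b := y)).exists_bound_of_continuousOn hu.continuousOn
  -- Feeding the bound back into `u = ∫ Q u` gains one power and one factorial each time; letting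
  -- `n` tend to infinity forces `u y = 0`.
  have hb : ∀ n : ℕ, ∀ z ∈ Set.uIcc a y, ‖u z‖ ≤ K * (C * |z - a|) ^ n / n.factorial := by
    intro n
    induction n with
    | zero => simpa using hK
    | succ n ih =>
      intro z hz
      rw [hint z]
      refine norm_integral_le_pow_div_factorial fun s hs => (norm_mul_le _ _).trans ?_
      exact mul_le_mul (hQ s) (ih s (Set.uIcc_subset_uIcc_left hz hs)) (norm_nonneg _) hC
  exact norm_le_zero_iff.mp (ge_of_tendsto' (tendsto_const_mul_pow_div_factorial _ _)
    fun n => hb n y Set.right_mem_uIcc)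

/-- As functions of `y`, both sides solve `u' = Q u` and agree at `y = z`. -/
lemma propagator_mul_propagator (y z x : ℝ) :
    propagator Q y z * propagator Q z x = propagator Q y x := by
  refine sub_eq_zero.mp (eq_zero_of_hasDerivAt_off_countable hS hQr hQ
    (u := fun y => propagator Q y z * propagator Q z x - propagator Q y x) (a := z) ?_ ?_ ?_ y)
  · exact ((continuous_propagator_left hS hQr hQ z).mul continuous_const).sub
      (continuous_propagator_left hS hQr hQ x)
  · simp [propagator_self hS hQr hQ]
  · intro y hy
    have := ((hasDerivAt_propagator hS hQr hQ z hy).mul_const (propagator Q z x)).sub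
      (hasDerivAt_propagator hS hQr hQ x hy)
    exact this.congr_deriv (by rw [mul_sub, mul_assoc])

/-- By the cocycle identity `M(y, s)` is the inverse of `M(s, y)`, and inversion is continuous at
units. -/
lemma continuous_propagator_right (y : ℝ) : Continuous fun s => propagator Q y s := by
  let e : ℝ → 𝔸ˣ := fun s => ⟨propagator Q s y, propagator Q y s,
    by rw [propagator_mul_propagator hS hQr hQ, propagator_self hS hQr hQ],
    by rw [propagator_mul_propagator hS hQr hQ, propagator_self hS hQr hQ]⟩
  have he : (fun s => propagator Q y s) = fun s => Ring.inverse (propagator Q s y) := by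
    funext s
    exact (Ring.inverse_unit (e s)).symm
  rw [he]
  refine continuous_iff_continuousAt.mpr fun s => ?_
  exact ContinuousAt.comp (f := fun s => propagator Q s y) (NormedRing.inverse_continuousAt (e s))
    (continuous_propagator_left hS hQr hQ y).continuousAt

lemma continuous_propagator : Continuous fun p : ℝ × ℝ => propagator Q p.1 p.2 := by
  have : (fun p : ℝ × ℝ => propagator Q p.1 p.2) =
      fun p => propagator Q p.1 0 * propagator Q 0 p.2 := by
    funext p; rw [propagator_mul_propagator hS hQr hQ]
  rw [this]
  exact ((continuous_propagator_left hS hQr hQ 0).comp continuous_fst).mul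
    ((continuous_propagator_right hS hQr hQ 0).comp continuous_snd)

/-! ### Variation of constants and the Dyson series -/

/-- The Volterra operator `u ↦ ∫₀^y M(y, s) P(s) u(s) ds` of the perturbation `P`. -/
noncomputable def duhamel (Q P : ℝ → 𝔸) (u : ℝ → 𝔸) (y : ℝ) : 𝔸 :=
  ∫ s in (0 : ℝ)..y, propagator Q y s * (P s * u s)

/-- Splitting `M(y, s) = M(y, 0) M(0, s)` takes `y` out of the integrand, so continuity and the
derivative in `y` follow from those of a product. -/
lemma duhamel_eq {P u : ℝ → 𝔸} (hP : RegulatedOff S P) (hu : Continuous u) (y : ℝ) :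
    duhamel Q P u y = propagator Q y 0 * ∫ s in (0 : ℝ)..y, propagator Q 0 s * (P s * u s) := by
  have hr : RegulatedOff S fun s => propagator Q 0 s * (P s * u s) :=
    (RegulatedOff.of_continuous (continuous_propagator_right hS hQr hQ 0)).mul
      (hP.mul (.of_continuous hu))
  have := (ContinuousLinearMap.mul ℝ 𝔸 (propagator Q y 0)).intervalIntegral_comp_comm
    (hr.intervalIntegrable hS 0 y)
  simp only [ContinuousLinearMap.mul_apply'] at this
  rw [← this, duhamel]
  simp only [← mul_assoc, propagator_mul_propagator hS hQr hQ]

lemma continuous_duhamel {P u : ℝ → 𝔸} (hP : RegulatedOff S P) (hu : Continuous u) :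
    Continuous (duhamel Q P u) := by
  rw [funext (duhamel_eq hS hQr hQ hP hu)]
  exact (continuous_propagator_left hS hQr hQ 0).mul
    (((RegulatedOff.of_continuous (continuous_propagator_right hS hQr hQ 0)).mul
      (hP.mul (.of_continuous hu))).continuous_integral hS 0)

lemma continuous_iterate_duhamel {P u : ℝ → 𝔸} (hP : RegulatedOff S P) (hu : Continuous u) (n : ℕ) :
    Continuous ((duhamel Q P)^[n] u) := by
  induction n with
  | zero => exact hu
  | succ n ih =>
    rw [Function.iterate_succ_apply']
    exact continuous_duhamel hS hQr hQ hP ih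

/-- Variation of constants. -/
lemma propagator_add_eq {P : ℝ → 𝔸} (hP : RegulatedOff S P) {D : ℝ}
    (hPb : ∀ y, ‖Q y + P y‖ ≤ D) (y : ℝ) :
    propagator (fun y => Q y + P y) y 0 =
      propagator Q y 0 + duhamel Q P (fun s => propagator (fun y => Q y + P y) s 0) y := by
  set R := fun y => Q y + P y with hR
  have hRr : RegulatedOff S R := hQr.add hP
  have hc := continuous_propagator_left hS hRr hPb 0
  rw [duhamel_eq hS hQr hQ hP hc, eq_comm]
  have hr : RegulatedOff S fun s => propagator Q 0 s * (P s * propagator R s 0) :=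
    (RegulatedOff.of_continuous (continuous_propagator_right hS hQr hQ 0)).mul
      (hP.mul (.of_continuous hc))
  -- The difference of the two sides solves the unperturbed equation: differentiating the integral
  -- yields `P R`-terms that cancel the `P` part of the perturbed derivative.
  refine sub_eq_zero.mp (eq_zero_of_hasDerivAt_off_countable hS hQr hQ (u := fun y =>
    propagator Q y 0 + propagator Q y 0 * (∫ s in (0 : ℝ)..y,
      propagator Q 0 s * (P s * propagator R s 0)) - propagator R y 0) (a := 0) ?_ ?_ ?_ y)
  · have h0 := continuous_propagator_left hS hQr hQ 0
    exact (h0.add (h0.mul (hr.continuous_integral hS 0))).sub hc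
  · simp [propagator_self hS hQr hQ, propagator_self hS hRr hPb]
  · intro y hy
    have h0 := hasDerivAt_propagator hS hQr hQ 0 hy
    have := (h0.add (h0.mul (hr.hasDerivAt_integral hS 0 hy))).sub
      (hasDerivAt_propagator hS hRr hPb 0 hy)
    refine this.congr_deriv ?_
    rw [← mul_assoc (propagator Q y 0), propagator_mul_propagator hS hQr hQ,
      propagator_self hS hQr hQ, hR]
    noncomm_ring

/-- Variation of constants substituted into itself `N` times; the remainder is the `N`-th iterate
applied to the perturbed propagator. -/
lemma propagator_add_eq_sum {P : ℝ → 𝔸} (hP : RegulatedOff S P) {D : ℝ}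
    (hPb : ∀ y, ‖Q y + P y‖ ≤ D) (N : ℕ) (y : ℝ) :
    propagator (fun y => Q y + P y) y 0 =
      ∑ k ∈ Finset.range N, (duhamel Q P)^[k] (fun s => propagator Q s 0) y +
        (duhamel Q P)^[N] (fun s => propagator (fun y => Q y + P y) s 0) y := by
  have hadd : ∀ u v : ℝ → 𝔸, Continuous u → Continuous v →
      duhamel Q P (fun s => u s + v s) = fun s => duhamel Q P u s + duhamel Q P v s := by
    intro u v hu hv
    funext y
    have hi : ∀ w : ℝ → 𝔸, Continuous w →
        IntervalIntegrable (fun s => propagator Q y s * (P s * w s)) volume 0 y := fun w hw =>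
      ((RegulatedOff.of_continuous (continuous_propagator_right hS hQr hQ y)).mul
        (hP.mul (.of_continuous hw))).intervalIntegrable hS 0 y
    simp only [duhamel, mul_add]
    exact intervalIntegral.integral_add (hi u hu) (hi v hv)
  have hc := continuous_propagator_left hS (hQr.add hP) hPb 0
  have h0 := continuous_propagator_left hS hQr hQ 0
  have key : ∀ N : ℕ, (duhamel Q P)^[N] (fun s => propagator (fun y => Q y + P y) s 0) =
      fun s => (duhamel Q P)^[N] (fun s => propagator Q s 0) s +
        (duhamel Q P)^[N + 1] (fun s => propagator (fun y => Q y + P y) s 0) s := by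
    intro N
    induction N with
    | zero => funext s; exact propagator_add_eq hS hQr hQ hP hPb s
    | succ N ih =>
      rw [Function.iterate_succ_apply', ih, hadd _ _ (continuous_iterate_duhamel hS hQr hQ hP h0 N)
        (continuous_iterate_duhamel hS hQr hQ hP hc (N + 1))]
      funext s
      simp only [Function.iterate_succ_apply']
  induction N with
  | zero => simp
  | succ N ih => rw [ih, Finset.sum_range_succ, add_assoc, key N]

/-- The Dyson expansion of the propagator of a perturbed system. -/
lemma tendsto_sum_iterate_duhamel {P : ℝ → 𝔸} (hP : RegulatedOff S P) {D B : ℝ}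
    (hPb : ∀ y, ‖Q y + P y‖ ≤ D) (hB : ∀ y, ‖P y‖ ≤ B) :
    Tendsto (fun N => ∑ k ∈ Finset.range N, (duhamel Q P)^[k] (fun s => propagator Q s 0) 1)
      atTop (𝓝 (propagator (fun y => Q y + P y) 1 0)) := by
  have hC : 0 ≤ C := (norm_nonneg _).trans (hQ 0)
  have hB0 : 0 ≤ B := (norm_nonneg _).trans (hB 0)
  have hc := continuous_propagator_left hS (hQr.add hP) hPb 0
  obtain ⟨K, hK⟩ := (isCompact_Icc (a := (0 : ℝ)) (b := 1)).exists_bound_of_continuousOn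
    hc.continuousOn
  -- On the unit interval the propagator contributes at most `exp C` and the perturbation at most
  -- `B` per iteration.
  set A := Real.exp C * B
  have hb : ∀ N : ℕ, ∀ y ∈ Set.Icc (0 : ℝ) 1,
      ‖(duhamel Q P)^[N] (fun s => propagator (fun y => Q y + P y) s 0) y‖ ≤
        K * (A * |y - 0|) ^ N / N.factorial := by
    intro N
    induction N with
    | zero => simpa using hK
    | succ N ih =>
      intro y hy
      rw [Function.iterate_succ_apply', duhamel]
      refine norm_integral_le_pow_div_factorial fun s hs => ?_
      rw [Set.uIcc_of_le hy.1] at hs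
      have hs' : s ∈ Set.Icc (0 : ℝ) 1 := ⟨hs.1, hs.2.trans hy.2⟩
      refine (norm_mul_le _ _).trans ?_
      rw [mul_assoc]
      refine mul_le_mul ((norm_propagator_le hQ y s).trans ?_) ((norm_mul_le _ _).trans
        (mul_le_mul (hB s) (ih s hs') (norm_nonneg _) hB0)) (norm_nonneg _) (Real.exp_pos _).le
      have : |y - s| ≤ 1 := by
        rw [abs_of_nonneg (by linarith [hs.2])]; linarith [hy.2, hs.1]
      exact Real.exp_le_exp.mpr (mul_le_of_le_one_right hC this)
  have h0 := squeeze_zero_norm (fun N => hb N 1 (by simp))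
    (tendsto_const_mul_pow_div_factorial K (A * |1 - 0|))
  have := (tendsto_const_nhds (x := propagator (fun y => Q y + P y) 1 0)).sub h0
  rw [sub_zero] at this
  refine this.congr fun N => ?_
  rw [propagator_add_eq_sum hS hQr hQ hP hPb N 1]
  simp

end Propagator

/-! ### Measurability, bounds and linearity of simplex integrals -/

section SimplexIntegral

lemma measurable_finCons {α : Type*} [MeasurableSpace α] {N : ℕ} {s : α → ℝ} {t : α → Fin N → ℝ}
    (hs : Measurable s) (ht : Measurable t) :
    Measurable fun a => (Fin.cons (s a) (t a) : Fin (N + 1) → ℝ) := by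
  refine measurable_pi_iff.mpr fun i => ?_
  refine Fin.cases ?_ (fun j => ?_) i
  · simpa using hs
  · simpa [Function.comp_def] using (measurable_pi_apply j).comp ht

lemma measurable_intervalIntegral_right {α : Type*} [MeasurableSpace α] {h : α × ℝ → ℂ}
    (hh : Measurable h) : Measurable fun p : α × ℝ => ∫ s in (0 : ℝ)..p.2, h (p.1, s) := by
  have key : ∀ T : Set ((α × ℝ) × ℝ), MeasurableSet T →
      Measurable fun p : α × ℝ => ∫ s in {s | (p, s) ∈ T}, h (p.1, s) := by
    intro T hT
    have h1 : Measurable fun q : (α × ℝ) × ℝ => T.indicator (fun q => h (q.1.1, q.2)) q :=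
      (hh.comp (by fun_prop)).indicator hT
    have h2 := (h1.stronglyMeasurable.integral_prod_right' (ν := (volume : Measure ℝ))).measurable
    convert h2 using 1
    funext p
    exact (integral_indicator (measurable_prodMk_left hT)).symm
  have h1 := key {q | 0 < q.2 ∧ q.2 ≤ q.1.2}
    ((measurableSet_lt measurable_const measurable_snd).inter
      (measurableSet_le measurable_snd (by fun_prop)))
  have h2 := key {q | q.1.2 < q.2 ∧ q.2 ≤ 0}
    ((measurableSet_lt (by fun_prop) measurable_snd).inter
      (measurableSet_le measurable_snd measurable_const))
  -- An interval integral is by definition the difference of the integrals over the two oppositely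
  -- oriented half-open intervals.
  exact h1.sub h2

/-- The parameter space `α` absorbs the outer variables: the induction step uses the hypothesis over
`α × ℝ`. -/
lemma measurable_iteratedSimplexIntegral {α : Type*} [MeasurableSpace α] (N : ℕ)
    {g : α → (Fin N → ℝ) → ℂ} (hg : Measurable (Function.uncurry g)) :
    Measurable fun p : α × ℝ => iteratedSimplexIntegral N p.2 (g p.1) := by
  induction N generalizing α with
  | zero => exact hg.comp (measurable_fst.prodMk measurable_const)
  | succ N ih =>
    have h := ih (α := α × ℝ) (g := fun p t => g p.1 (Fin.cons p.2 t))
      (hg.comp ((by fun_prop : Measurable fun p : (α × ℝ) × (Fin N → ℝ) => p.1.1).prodMk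
        (measurable_finCons (by fun_prop) (by fun_prop))))
    exact measurable_intervalIntegral_right (α := α)
      (h := fun p => iteratedSimplexIntegral N p.2 fun t => g p.1 (Fin.cons p.2 t))
      (h.comp (measurable_id.prodMk measurable_snd))

lemma finCons_mem_unitInterval {N : ℕ} {s : ℝ} (hs : s ∈ Set.Icc (0 : ℝ) 1) {t : Fin N → ℝ}
    (ht : ∀ i, t i ∈ Set.Icc (0 : ℝ) 1) (i : Fin (N + 1)) :
    (Fin.cons s t : Fin (N + 1) → ℝ) i ∈ Set.Icc (0 : ℝ) 1 := by
  refine Fin.cases ?_ (fun j => ?_) i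
  · simpa using hs
  · simpa using ht j

lemma norm_iteratedSimplexIntegral_le {N : ℕ} {g : (Fin N → ℝ) → ℂ} {K : ℝ}
    (hK : ∀ t : Fin N → ℝ, (∀ i, t i ∈ Set.Icc (0 : ℝ) 1) → ‖g t‖ ≤ K) {b : ℝ}
    (hb : b ∈ Set.Icc (0 : ℝ) 1) :
    ‖iteratedSimplexIntegral N b g‖ ≤ K * b ^ N / N.factorial := by
  induction N generalizing b with
  | zero => simpa [iteratedSimplexIntegral] using hK ![] (fun i => i.elim0)
  | succ N ih =>
    have := norm_integral_le_pow_div_factorial (a := 0) (y := b) (K := K) (C := 1) (n := N)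
      (h := fun s => iteratedSimplexIntegral N s fun t => g (Fin.cons s t)) fun s hs => by
        rw [Set.uIcc_of_le hb.1] at hs
        have hs' : s ∈ Set.Icc (0 : ℝ) 1 := ⟨hs.1, hs.2.trans hb.2⟩
        have := ih (g := fun t => g (Fin.cons s t))
          (fun t ht => hK _ (finCons_mem_unitInterval hs' ht)) hs'
        simpa [abs_of_nonneg hs.1] using this
    simpa [iteratedSimplexIntegral, abs_of_nonneg hb.1] using this

lemma intervalIntegrable_iteratedSimplexIntegral {N : ℕ} {g : (Fin (N + 1) → ℝ) → ℂ} {K : ℝ}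
    (hg : Measurable g) (hK : ∀ t : Fin (N + 1) → ℝ, (∀ i, t i ∈ Set.Icc (0 : ℝ) 1) → ‖g t‖ ≤ K)
    {b : ℝ} (hb : b ∈ Set.Icc (0 : ℝ) 1) :
    IntervalIntegrable (fun s => iteratedSimplexIntegral N s fun t => g (Fin.cons s t))
      volume 0 b := by
  have hm : Measurable fun s : ℝ => iteratedSimplexIntegral N s fun t => g (Fin.cons s t) :=
    (measurable_iteratedSimplexIntegral (α := ℝ) N (g := fun s t => g (Fin.cons s t))
      (hg.comp (measurable_finCons measurable_fst measurable_snd))).comp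
      (measurable_id.prodMk measurable_id)
  have hK0 : 0 ≤ K := (norm_nonneg _).trans (hK (fun _ => 0) fun _ => by simp)
  refine (intervalIntegrable_const (c := K)).mono_fun hm.aestronglyMeasurable ?_
  refine (ae_restrict_mem measurableSet_uIoc).mono fun s hs => ?_
  rw [Set.uIoc_of_le hb.1] at hs
  have hs' : s ∈ Set.Icc (0 : ℝ) 1 := ⟨hs.1.le, hs.2.trans hb.2⟩
  refine (norm_iteratedSimplexIntegral_le (g := fun t => g (Fin.cons s t))
    (fun t ht => hK _ (finCons_mem_unitInterval hs' ht)) hs').trans ?_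
  rw [Real.norm_eq_abs, abs_of_nonneg hK0, mul_div_assoc]
  refine mul_le_of_le_one_right hK0 ((div_le_self (pow_nonneg hs'.1 _) ?_).trans
    (pow_le_one₀ hs'.1 hs'.2))
  exact_mod_cast N.factorial_pos

lemma iteratedSimplexIntegral_sum {ι : Type*} (J : Finset ι) (c : ι → ℂ) {N : ℕ}
    {g : ι → (Fin N → ℝ) → ℂ} (hg : ∀ j ∈ J, Measurable (g j))
    (hK : ∀ j ∈ J, ∃ K : ℝ, ∀ t : Fin N → ℝ, (∀ i, t i ∈ Set.Icc (0 : ℝ) 1) → ‖g j t‖ ≤ K)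
    {b : ℝ} (hb : b ∈ Set.Icc (0 : ℝ) 1) :
    iteratedSimplexIntegral N b (fun t => ∑ j ∈ J, c j * g j t) =
      ∑ j ∈ J, c j * iteratedSimplexIntegral N b (g j) := by
  induction N generalizing b with
  | zero => rfl
  | succ N ih =>
    simp only [iteratedSimplexIntegral]
    have : ∀ s ∈ Set.uIcc 0 b,
        iteratedSimplexIntegral N s (fun t => ∑ j ∈ J, c j * g j (Fin.cons s t)) =
          ∑ j ∈ J, c j * iteratedSimplexIntegral N s fun t => g j (Fin.cons s t) := by
      intro s hs
      rw [Set.uIcc_of_le hb.1] at hs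
      have hs' : s ∈ Set.Icc (0 : ℝ) 1 := ⟨hs.1, hs.2.trans hb.2⟩
      refine ih (g := fun j t => g j (Fin.cons s t)) (fun j hj => (hg j hj).comp
        (measurable_finCons measurable_const measurable_id)) (fun j hj => ?_) hs'
      obtain ⟨K, hK⟩ := hK j hj
      exact ⟨K, fun t ht => hK _ (finCons_mem_unitInterval hs' ht)⟩
    rw [intervalIntegral.integral_congr this, intervalIntegral.integral_finsetSum]
    · simp only [intervalIntegral.integral_const_mul]
    · intro j hj
      obtain ⟨K, hK⟩ := hK j hj
      exact (intervalIntegrable_iteratedSimplexIntegral (hg j hj) hK hb).const_mul _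

end SimplexIntegral

/-! ### Dyson terms as simplex integrals -/

section Dyson

variable {𝔸 : Type*} [NormedRing 𝔸] [NormedAlgebra ℝ 𝔸]

/-- The integrand `M(b, t₀) P(t₀) M(t₀, t₁) ⋯ P(t_{N-1}) M(t_{N-1}, 0)` of a term of the Dyson
expansion. -/
noncomputable def dysonIntegrand (Q P : ℝ → 𝔸) : (N : ℕ) → ℝ → (Fin N → ℝ) → 𝔸
  | 0, b, _ => propagator Q b 0
  | N + 1, b, t => propagator Q b (t 0) * (P (t 0) * dysonIntegrand Q P N (t 0) (Fin.tail t))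

/-- The induction runs over all functionals: moving `φ` under the outer integral leaves `X ↦ φ (M(b,
s) P(s) X)`, again a continuous functional. -/
lemma map_iterate_duhamel [NormOneClass 𝔸] [CompleteSpace 𝔸] {S : Set ℝ} (hS : S.Countable)
    {Q P : ℝ → 𝔸} (hQr : RegulatedOff S Q) {C : ℝ} (hQ : ∀ y, ‖Q y‖ ≤ C) (hP : RegulatedOff S P)
    (φ : 𝔸 →L[ℝ] ℂ) (N : ℕ) (b : ℝ) :
    φ ((duhamel Q P)^[N] (fun s => propagator Q s 0) b) =
      iteratedSimplexIntegral N b fun t => φ (dysonIntegrand Q P N b t) := by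
  induction N generalizing φ b with
  | zero => rfl
  | succ N ih =>
    have hc := continuous_iterate_duhamel hS hQr hQ hP
      (continuous_propagator_left hS hQr hQ 0) N
    have hi : IntervalIntegrable (fun s => propagator Q b s * (P s *
        (duhamel Q P)^[N] (fun s => propagator Q s 0) s)) volume 0 b :=
      ((RegulatedOff.of_continuous (continuous_propagator_right hS hQr hQ b)).mul
        (hP.mul (.of_continuous hc))).intervalIntegrable hS 0 b
    rw [Function.iterate_succ_apply', duhamel, ← φ.intervalIntegral_comp_comm hi]
    simp only [iteratedSimplexIntegral]
    refine intervalIntegral.integral_congr fun s _ => ?_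
    exact ih (φ ∘L (ContinuousLinearMap.mul ℝ 𝔸 (propagator Q b s)) ∘L
      (ContinuousLinearMap.mul ℝ 𝔸 (P s))) s

end Dyson

/-! ### Rank-one collapse and the cyclic trace -/

section Matrix

open scoped Matrix.Norms.Operator

/-- Evaluation of a matrix entry as a continuous linear map. -/
noncomputable def matrixEntry (i j : Fin 2) : Matrix (Fin 2) (Fin 2) ℂ →L[ℝ] ℂ :=
  LinearMap.toContinuousLinearMap (Matrix.entryLinearMap ℝ ℂ i j)

/-- The matrix unit `E₂₁`. -/
def lowerUnit : Matrix (Fin 2) (Fin 2) ℂ := !![0, 0; 1, 0]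

lemma mul_lowerUnit_mul_apply (X Y : Matrix (Fin 2) (Fin 2) ℂ) (i j : Fin 2) :
    (X * (lowerUnit * Y)) i j = X i 1 * Y 0 j := by
  rw [Matrix.mul_apply, Fin.sum_univ_two, Matrix.mul_apply, Matrix.mul_apply]
  simp [lowerUnit, Fin.sum_univ_two]

lemma lowerUnit_mul_apply (Y : Matrix (Fin 2) (Fin 2) ℂ) (i j : Fin 2) :
    (lowerUnit * Y) i j = (1 : Matrix (Fin 2) (Fin 2) ℂ) i 1 * Y 0 j := by
  rw [← mul_lowerUnit_mul_apply, one_mul]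

variable {S : Set ℝ} (hS : S.Countable) {Q : ℝ → Matrix (Fin 2) (Fin 2) ℂ}
  (hQr : RegulatedOff S Q) {C : ℝ} (hQ : ∀ y, ‖Q y‖ ≤ C)

include hS hQr in
lemma peanoTerm_eq_picardTerm (y₀ : ℝ) (n : ℕ) (y : ℝ) :
    peanoTerm Q y₀ n y = picardTerm Q y₀ n y := by
  induction n generalizing y with
  | zero => rfl
  | succ n ih =>
    ext i j
    simp only [peanoTerm, picardTerm, ih, Matrix.of_apply]
    exact (matrixEntry i j).intervalIntegral_comp_comm
      ((hQr.mul (.of_continuous (continuous_picardTerm hS hQr y₀ n))).intervalIntegrable hS y₀ y)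

include hS hQr hQ in
lemma hasSum_peanoTerm_apply (y₀ y : ℝ) (i j : Fin 2) :
    HasSum (fun n => peanoTerm Q y₀ n y i j) (propagator Q y y₀ i j) := by
  simp only [peanoTerm_eq_picardTerm hS hQr]
  exact (matrixEntry i j).hasSum (hasSum_picardTerm hQ y₀ y)

include hS hQr hQ in
lemma matricant_eq_propagator (y y₀ : ℝ) : matricant Q y y₀ = propagator Q y y₀ := by
  ext i j
  exact (hasSum_peanoTerm_apply hS hQr hQ y₀ y i j).tsum_eq

lemma dysonIntegrand_single (g : ℝ → ℂ) (N : ℕ) (b : ℝ) (t : Fin (N + 1) → ℝ) :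
    dysonIntegrand Q (fun s => g s • lowerUnit) (N + 1) b t =
      ((∏ i, g (t i)) * ∏ i : Fin N, propagator Q (t i.castSucc) (t i.succ) 0 1) •
        (propagator Q b (t 0) * (lowerUnit * propagator Q (t (Fin.last N)) 0)) := by
  -- The collapse `E₂₁ X E₂₁ = X₁₂ E₂₁`, which makes the inner factors scalar.
  have hE : ∀ X Y : Matrix (Fin 2) (Fin 2) ℂ,
      lowerUnit * (X * (lowerUnit * Y)) = X 0 1 • (lowerUnit * Y) := by
    intro X Y
    ext i j
    rw [lowerUnit_mul_apply, mul_lowerUnit_mul_apply, Matrix.smul_apply, lowerUnit_mul_apply,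
      smul_eq_mul]
    ring
  induction N generalizing b with
  | zero => simp [dysonIntegrand]
  | succ N ih =>
    rw [dysonIntegrand, ih, Fin.prod_univ_succ (fun i => g (t i)),
      Fin.prod_univ_succ (fun i : Fin (N + 1) => propagator Q (t i.castSucc) (t i.succ) 0 1)]
    simp only [Fin.tail, smul_mul_assoc, mul_smul_comm, hE, smul_smul, Fin.succ_last,
      Fin.castSucc_zero, Fin.succ_castSucc]
    congr 1
    ring

include hS hQr hQ in
lemma trace_dysonIntegrand (hper : Function.Periodic Q 1) (g : ℝ → ℂ) (N : ℕ)
    (t : Fin (N + 1) → ℝ) :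
    (dysonIntegrand Q (fun s => g s • lowerUnit) (N + 1) 1 t).trace =
      (∏ i, g (t i)) * cyclicProduct (fun y y₀ => propagator Q y y₀ 0 1) (N + 1) t := by
  -- Periodicity replaces `M(t_last, 0)` by `M(t_last + 1, 1)`, which composes with `M(1, t₀)`; this
  -- is the source of the shift by one.
  have h : propagator Q (t (Fin.last N) + 1) (t 0) =
      propagator Q (t (Fin.last N)) 0 * propagator Q 1 (t 0) := by
    rw [← propagator_mul_propagator hS hQr hQ _ 1, ← propagator_add_one hper _ 0, zero_add]
  rw [dysonIntegrand_single, Matrix.trace_smul, cyclicProduct, h]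
  simp only [Matrix.trace_fin_two, mul_lowerUnit_mul_apply, smul_eq_mul]
  rw [Matrix.mul_apply, Fin.sum_univ_two]
  ring

end Matrix

/-! ### Derivatives and analyticity from double power series -/

section PowerSeries

lemma hasSum_sum_antidiagonal {g : ℕ × ℕ → ℂ} {z : ℂ} (hg : HasSum g z) :
    HasSum (fun N => ∑ q ∈ Finset.HasAntidiagonal.antidiagonal N, g q) z := by
  have h := Finset.HasAntidiagonal.sigmaAntidiagonalEquivProd.hasSum_iff.mpr hg
  exact h.sigma fun N => (Finset.HasAntidiagonal.antidiagonal N).hasSum g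

lemma iteratedDeriv_eq_of_hasSum {f : ℂ → ℂ} {z : ℂ} {a : ℕ → ℂ}
    (hf : ∀ y, HasSum (fun k => a k * y ^ k) (f (z + y))) (m : ℕ) :
    iteratedDeriv m f z = m.factorial * a m := by
  have hp : HasFPowerSeriesOnBall f (FormalMultilinearSeries.ofScalars ℂ a) z 1 := by
    refine ⟨?_, one_pos, fun {y} _ => ?_⟩
    -- Convergence at `y = 1` makes the coefficients tend to zero, so the radius is at least one.
    · refine FormalMultilinearSeries.le_radius_of_tendsto _ (r := 1) (l := 0) ?_
      have := (hf 1).summable.tendsto_atTop_zero.norm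
      simpa using this
    · simpa [FormalMultilinearSeries.ofScalars_apply_eq, mul_comm] using hf y
  have h := hp.factorial_smul 1 m
  rw [iteratedDeriv_eq_iteratedFDeriv, ← h]
  simp

variable {f : ℂ → ℂ → ℂ} {w κ : ℂ} {c : ℕ → ℕ → ℂ}
  (hf : ∀ x y, HasSum (fun p : ℕ × ℕ => c p.1 p.2 * x ^ p.1 * y ^ p.2) (f (w + x) (κ + y)))

include hf

/-- Unconditional summability allows regrouping by powers of `y`; the `m`-th coefficient is then
itself a power series in `x`. -/
lemma iteratedDeriv_iteratedDeriv_eq_of_hasSum (n m : ℕ) :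
    iteratedDeriv n (fun w' => iteratedDeriv m (fun κ' => f w' κ') κ) w =
      n.factorial * m.factorial * c n m := by
  have hs : ∀ x y, Summable fun p : ℕ × ℕ => c p.1 p.2 * x ^ p.1 * y ^ p.2 :=
    fun x y => (hf x y).summable
  have h1 : ∀ x, iteratedDeriv m (fun κ' => f (w + x) κ') κ =
      m.factorial * ∑' k, c k m * x ^ k := by
    intro x
    refine iteratedDeriv_eq_of_hasSum (a := fun m => ∑' k, c k m * x ^ k) (fun y => ?_) m
    have h2 := ((Equiv.prodComm ℕ ℕ).hasSum_iff.mpr (hf x y))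
    convert h2.prod_fiberwise fun l => (h2.summable.prod_factor l).hasSum using 1
    funext l
    simp [tsum_mul_right]
  have h3 : ∀ x, HasSum (fun k => m.factorial * c k m * x ^ k)
      (iteratedDeriv m (fun κ' => f (w + x) κ') κ) := by
    intro x
    -- At `y = 1` the factor `y ^ m` disappears, leaving summability of the column series in `x`.
    have := (((Equiv.prodComm ℕ ℕ).summable_iff.mpr (hs x 1)).prod_factor m)
    simp only [Function.comp_def, Equiv.prodComm_apply, Prod.fst_swap, Prod.snd_swap, one_pow,
      mul_one] at this
    rw [h1]
    simpa only [mul_assoc] using this.hasSum.mul_left (m.factorial : ℂ)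
  rw [iteratedDeriv_eq_of_hasSum h3 n, mul_assoc]

/-- A double series with coefficients bounded by `K A ^ N / N!` in total degree `N` is analytic. -/
lemma analyticAt_of_hasSum {K A : ℝ} (hA : 0 ≤ A)
    (hc : ∀ n m, ‖c n m‖ ≤ K * (A ^ (n + m) / (n + m).factorial)) :
    AnalyticAt ℂ (fun p : ℂ × ℂ => f p.1 p.2) (w, κ) := by
  -- The first `n` slots read the first coordinate and the others the second, so on the diagonal the
  -- product is the monomial `v.1 ^ n * v.2 ^ m`.
  let L : ℕ → ℕ → ℂ × ℂ →L[ℂ] ℂ := fun n i =>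
    if i < n then ContinuousLinearMap.fst ℂ ℂ ℂ else ContinuousLinearMap.snd ℂ ℂ ℂ
  have hL : ∀ n i, ‖L n i‖ ≤ 1 := by
    intro n i
    simp only [L]
    split_ifs
    · exact ContinuousLinearMap.norm_fst_le ℂ ℂ ℂ
    · exact ContinuousLinearMap.norm_snd_le ℂ ℂ ℂ
  let p : FormalMultilinearSeries ℂ (ℂ × ℂ) ℂ := fun N =>
    ∑ q ∈ Finset.HasAntidiagonal.antidiagonal N, c q.1 q.2 •
      (ContinuousMultilinearMap.mkPiAlgebra ℂ (Fin N) ℂ).compContinuousLinearMap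
        fun i => L q.1 i
  have hp : ∀ N v, (p N fun _ => v) =
      ∑ q ∈ Finset.HasAntidiagonal.antidiagonal N, c q.1 q.2 * v.1 ^ q.1 * v.2 ^ q.2 := by
    intro N v
    simp only [p, sum_apply, smul_apply,
      ContinuousMultilinearMap.compContinuousLinearMap_apply,
      ContinuousMultilinearMap.mkPiAlgebra_apply, smul_eq_mul]
    refine Finset.sum_congr rfl fun q hq => ?_
    obtain rfl := Finset.HasAntidiagonal.mem_antidiagonal.mp hq
    rw [mul_assoc, Fin.prod_univ_add]
    simp [L]
  have hbound : ∀ N, ‖p N‖ ≤ (N + 1) * (K * (A ^ N / N.factorial)) := by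
    intro N
    refine (norm_sum_le _ _).trans ?_
    have : ∀ q ∈ Finset.HasAntidiagonal.antidiagonal N, ‖c q.1 q.2 •
        (ContinuousMultilinearMap.mkPiAlgebra ℂ (Fin N) ℂ).compContinuousLinearMap
        fun i => L q.1 i‖ ≤ K * (A ^ N / N.factorial) := by
      intro q hq
      rw [norm_smul]
      have h1 := hc q.1 q.2
      rw [Finset.HasAntidiagonal.mem_antidiagonal.mp hq] at h1
      refine (mul_le_of_le_one_right (norm_nonneg _) ?_).trans h1
      refine (ContinuousMultilinearMap.norm_compContinuousLinearMap_le _ _).trans ?_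
      rw [ContinuousMultilinearMap.norm_mkPiAlgebra, one_mul]
      exact Finset.prod_le_one (fun _ _ => norm_nonneg _) fun i _ => hL _ _
    refine (Finset.sum_le_card_nsmul _ _ _ this).trans (le_of_eq ?_)
    simp
  refine HasFPowerSeriesOnBall.analyticAt (r := 1) (p := p) ⟨?_, one_pos, fun {v} _ => ?_⟩
  · refine FormalMultilinearSeries.le_radius_of_tendsto _ (r := 1) (l := 0) ?_
    have hlim := tendsto_const_mul_pow_div_factorial K (2 * A)
    refine squeeze_zero (fun n => by positivity) (fun N => ?_) hlim
    have hK : 0 ≤ K := by simpa using (norm_nonneg _).trans (hc 0 0)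
    -- The `N + 1` monomials of degree `N` are absorbed by doubling `A`.
    have h2 : (N + 1 : ℝ) ≤ 2 ^ N := by exact_mod_cast N.lt_two_pow_self
    calc ‖p N‖ * ((1 : NNReal) : ℝ) ^ N ≤ (N + 1) * (K * (A ^ N / N.factorial)) := by
          simpa using hbound N
      _ ≤ 2 ^ N * (K * (A ^ N / N.factorial)) := by gcongr
      _ = K * (2 * A) ^ N / N.factorial := by rw [mul_pow]; ring
  · simp only [hp]
    exact hasSum_sum_antidiagonal (hf v.1 v.2)

end PowerSeries

/-! ### Boundedness and measurability of the coefficients -/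

section Coefficients

lemma PiecewiseContinuous.countable_discontinuities {f : ℝ → ℝ} (hf : PiecewiseContinuous f) :
    {y | ¬ ContinuousAt f y}.Countable := by
  have h : {y | ¬ ContinuousAt f y} ⊆
      ⋃ n : ℕ, {y ∈ Set.Icc (-(n : ℝ)) n | ¬ ContinuousAt f y} := by
    intro y hy
    obtain ⟨n, hn⟩ := exists_nat_ge |y|
    exact Set.mem_iUnion.mpr ⟨n, abs_le.mp hn, hy⟩
  exact (Set.countable_iUnion fun n => (hf.finite_discontinuities _ _).countable).mono h

lemma PiecewiseContinuous.exists_bound_nhds {f : ℝ → ℝ} (hf : PiecewiseContinuous f) (y : ℝ) :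
    ∃ B, ∀ᶠ z in 𝓝 y, |f z| ≤ B := by
  obtain ⟨l, hl⟩ := hf.exists_left_limit y
  obtain ⟨r, hr⟩ := hf.exists_right_limit y
  refine ⟨max (max (|l| + 1) (|r| + 1)) |f y|, ?_⟩
  have h1 := hl.abs.eventually_le_const (lt_add_one |l|)
  have h2 := hr.abs.eventually_le_const (lt_add_one |r|)
  rw [eventually_nhdsWithin_iff] at h1 h2
  filter_upwards [h1, h2] with z h1 h2
  rcases lt_trichotomy z y with h | rfl | h
  · exact (h1 h).trans ((le_max_left _ _).trans (le_max_left _ _))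
  · exact le_max_right _ _
  · exact (h2 h).trans ((le_max_right _ _).trans (le_max_left _ _))

lemma IsMaterialCoefficient.exists_bound {f : ℝ → ℝ} (hf : IsMaterialCoefficient f) :
    ∃ B, ∀ y, |f y| ≤ B := by
  have : ∃ B, ∀ y ∈ Set.Icc (0 : ℝ) 1, |f y| ≤ B := by
    refine isCompact_Icc.induction_on (p := fun s => ∃ B, ∀ y ∈ s, |f y| ≤ B) ⟨0, by simp⟩
      (fun s t hst ⟨B, hB⟩ => ⟨B, fun y hy => hB y (hst hy)⟩) ?_ fun y _ => ?_
    · rintro s t ⟨B, hB⟩ ⟨D, hD⟩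
      refine ⟨max B D, fun y hy => hy.elim (fun h => ?_) fun h => ?_⟩
      · exact (hB y h).trans (le_max_left _ _)
      · exact (hD y h).trans (le_max_right _ _)
    · obtain ⟨B, hB⟩ := hf.piecewiseContinuous.exists_bound_nhds y
      exact ⟨_, mem_nhdsWithin_of_mem_nhds hB, B, fun z hz => hz⟩
  obtain ⟨B, hB⟩ := this
  refine ⟨B, fun y => ?_⟩
  obtain ⟨z, hz, hyz⟩ := hf.periodic.exists_mem_Ico₀ one_pos y
  rw [hyz]
  exact hB z (Set.Ico_subset_Icc_self hz)

/-- Genuine measurability, not just almost everywhere, is needed: iterated integrals restrict the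
integrand to slices. -/
lemma measurable_of_countable_discontinuities {f : ℝ → ℝ} {S : Set ℝ} (hS : S.Countable)
    (hf : ∀ y ∉ S, ContinuousAt f y) : Measurable f := by
  refine measurable_of_isOpen fun U hU => ?_
  have h1 : MeasurableSet (f ⁻¹' U ∩ S) := (hS.mono Set.inter_subset_right).measurableSet
  have hc : ContinuousOn f Sᶜ := fun y hy => (hf y hy).continuousWithinAt
  obtain ⟨V, hV, hVU⟩ := continuousOn_iff'.mp hc U hU
  have h2 : MeasurableSet (f ⁻¹' U ∩ Sᶜ) := by
    rw [hVU]; exact hV.measurableSet.inter hS.measurableSet.compl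
  rw [← Set.inter_union_compl (f ⁻¹' U) S]
  exact h1.union h2

/-- Coefficients of the system that are periodic, bounded by `B` together with `1 / μ₁`, and
continuous off the countable set `S`. -/
structure AdmissibleCoefficients (ρ μ₁ μ₂ : ℝ → ℝ) (S : Set ℝ) (B : ℝ) : Prop where
  countable : S.Countable
  periodic_ρ : Function.Periodic ρ 1
  periodic_μ₁ : Function.Periodic μ₁ 1
  periodic_μ₂ : Function.Periodic μ₂ 1
  continuousAt_ρ : ∀ y ∉ S, ContinuousAt ρ y
  continuousAt_μ₁_inv : ∀ y ∉ S, ContinuousAt (fun y => (μ₁ y)⁻¹) y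
  continuousAt_μ₂ : ∀ y ∉ S, ContinuousAt μ₂ y
  bound_ρ : ∀ y, |ρ y| ≤ B
  bound_μ₁_inv : ∀ y, |(μ₁ y)⁻¹| ≤ B
  bound_μ₂ : ∀ y, |μ₂ y| ≤ B

lemma exists_admissibleCoefficients {ρ μ₁ μ₂ : ℝ → ℝ} (hρ : IsMaterialCoefficient ρ)
    (hμ₁ : IsMaterialCoefficient μ₁) (hμ₂ : IsMaterialCoefficient μ₂)
    (hμ₁_bdd : ∃ c : ℝ, 0 < c ∧ ∀ y, c ≤ μ₁ y) :
    ∃ S B, AdmissibleCoefficients ρ μ₁ μ₂ S B := by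
  obtain ⟨c, hc, hcμ⟩ := hμ₁_bdd
  obtain ⟨B₁, hB₁⟩ := hρ.exists_bound
  obtain ⟨B₂, hB₂⟩ := hμ₂.exists_bound
  refine ⟨{y | ¬ ContinuousAt ρ y} ∪ {y | ¬ ContinuousAt μ₁ y} ∪ {y | ¬ ContinuousAt μ₂ y},
    max (max B₁ B₂) c⁻¹, ?_⟩
  exact {
    countable := (hρ.piecewiseContinuous.countable_discontinuities.union
      hμ₁.piecewiseContinuous.countable_discontinuities).union
      hμ₂.piecewiseContinuous.countable_discontinuities
    periodic_ρ := hρ.periodic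
    periodic_μ₁ := hμ₁.periodic
    periodic_μ₂ := hμ₂.periodic
    continuousAt_ρ := fun y hy => by
      by_contra h; exact hy (Or.inl (Or.inl h))
    continuousAt_μ₁_inv := fun y hy => by
      refine ContinuousAt.inv₀ ?_ (hμ₁.pos y).ne'
      by_contra h; exact hy (Or.inl (Or.inr h))
    continuousAt_μ₂ := fun y hy => by
      by_contra h; exact hy (Or.inr h)
    bound_ρ := fun y => (hB₁ y).trans ((le_max_left _ _).trans (le_max_left _ _))
    bound_μ₁_inv := fun y => by
      rw [abs_of_pos (inv_pos.mpr (hμ₁.pos y))]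
      exact (inv_anti₀ hc (hcμ y)).trans (le_max_right _ _)
    bound_μ₂ := fun y => (hB₂ y).trans ((le_max_right _ _).trans (le_max_left _ _)) }

end Coefficients

/-! ### Weights, cyclic products and the system matrix -/

/-- `symmetrizedWeight` with the number `N = n + m` of variables as a free parameter. -/
noncomputable def degreeWeight (ρ μ₂ : ℝ → ℝ) (N m : ℕ) (ς : Fin N → ℝ) : ℝ :=
  ∑ σ : Fin N → Fin 2 with ∑ i, (σ i : ℕ) = m, ∏ i, ![ρ, μ₂] (σ i) (ς i)

/-- Each `σ` records which summand is taken from each factor; grouping by the number of ones gives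
the powers of `u` and `v`. -/
lemma prod_eq_sum_degreeWeight (ρ μ₂ : ℝ → ℝ) (u v : ℂ) (N : ℕ) (t : Fin N → ℝ) :
    ∏ i, (ρ (t i) * u + μ₂ (t i) * v) =
      ∑ p ∈ Finset.HasAntidiagonal.antidiagonal N,
        (u ^ p.1 * v ^ p.2) * (degreeWeight ρ μ₂ N p.2 t : ℂ) := by
  have h1 : ∀ i, (ρ (t i) * u + μ₂ (t i) * v : ℂ) =
      ∑ j : Fin 2, (![ρ, μ₂] j (t i) : ℂ) * (u ^ (1 - (j : ℕ)) * v ^ (j : ℕ)) := by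
    intro i; simp [Fin.sum_univ_two]
  have hcard : ∀ σ : Fin N → Fin 2, ∑ i, (1 - (σ i : ℕ)) + ∑ i, (σ i : ℕ) = N := by
    intro σ
    rw [← Finset.sum_add_distrib]
    have : ∀ i, 1 - (σ i : ℕ) + (σ i : ℕ) = 1 := fun i => by omega
    simp [this]
  simp only [h1]
  rw [Finset.prod_univ_sum, Fintype.piFinset_univ,
    ← Finset.sum_fiberwise_of_maps_to (t := Finset.HasAntidiagonal.antidiagonal N)
      (g := fun σ : Fin N → Fin 2 => (∑ i, (1 - (σ i : ℕ)), ∑ i, (σ i : ℕ)))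
      (fun σ _ => Finset.HasAntidiagonal.mem_antidiagonal.mpr (hcard σ))]
  refine Finset.sum_congr rfl fun p hp => ?_
  have hp' := Finset.HasAntidiagonal.mem_antidiagonal.mp hp
  have hfilter : (Finset.univ.filter fun σ : Fin N → Fin 2 =>
      (∑ i, (1 - (σ i : ℕ)), ∑ i, (σ i : ℕ)) = p) =
      Finset.univ.filter fun σ : Fin N → Fin 2 => ∑ i, (σ i : ℕ) = p.2 := by
    refine Finset.filter_congr fun σ _ => ?_
    rw [Prod.ext_iff]
    have := hcard σ
    constructor
    · exact fun h => h.2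
    · exact fun h => ⟨by simp only; omega, h⟩
  rw [hfilter, degreeWeight, Complex.ofReal_sum, Finset.mul_sum]
  refine Finset.sum_congr rfl fun σ hσ => ?_
  have hσ' := (Finset.mem_filter.mp hσ).2
  have hσ'' : ∑ i, (1 - (σ i : ℕ)) = p.1 := by have := hcard σ; omega
  rw [Finset.prod_mul_distrib, Finset.prod_mul_distrib, Finset.prod_pow_eq_pow_sum,
    Finset.prod_pow_eq_pow_sum, hσ', hσ'', Complex.ofReal_prod, mul_comm]

lemma continuous_cyclicProduct {K : ℝ → ℝ → ℂ} (hK : Continuous fun p : ℝ × ℝ => K p.1 p.2)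
    (N : ℕ) : Continuous (cyclicProduct K N) := by
  cases N with
  | zero => exact continuous_const
  | succ N =>
    have h : ∀ a b : (Fin (N + 1) → ℝ) → ℝ, Continuous a → Continuous b →
        Continuous fun t => K (a t) (b t) := fun a b ha hb => hK.comp (ha.prodMk hb)
    exact (h _ _ (by fun_prop) (by fun_prop)).mul
      (continuous_finsetProd _ fun i _ => h _ _ (by fun_prop) (by fun_prop))

/-- The first argument ranges over `[0, 2]` because the closing factor is evaluated at `ς_N + 1`. -/
lemma norm_cyclicProduct_le {K : ℝ → ℝ → ℂ} {A : ℝ}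
    (hA : ∀ y ∈ Set.Icc (0 : ℝ) 2, ∀ s ∈ Set.Icc (0 : ℝ) 1, ‖K y s‖ ≤ A) (N : ℕ)
    (t : Fin N → ℝ) (ht : ∀ i, t i ∈ Set.Icc (0 : ℝ) 1) : ‖cyclicProduct K N t‖ ≤ A ^ N := by
  cases N with
  | zero => simp [cyclicProduct]
  | succ N =>
    have hA0 : 0 ≤ A := (norm_nonneg _).trans (hA 0 (by simp) 0 (by simp))
    rw [cyclicProduct, norm_mul, pow_succ', norm_prod]
    refine mul_le_mul (hA _ ⟨?_, ?_⟩ _ (ht 0)) ?_ (by positivity) hA0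
    · linarith [(ht (Fin.last N)).1]
    · linarith [(ht (Fin.last N)).2]
    · refine (Finset.prod_le_prod (fun _ _ => norm_nonneg _) fun i _ =>
        hA _ ⟨(ht i.castSucc).1, (ht i.castSucc).2.trans one_le_two⟩ _ (ht i.succ)).trans ?_
      simp

lemma abs_degreeWeight_le {ρ μ₂ : ℝ → ℝ} {B : ℝ} (hρ : ∀ y, |ρ y| ≤ B) (hμ : ∀ y, |μ₂ y| ≤ B)
    (N m : ℕ) (t : Fin N → ℝ) : |degreeWeight ρ μ₂ N m t| ≤ (2 * B) ^ N := by
  have hB : 0 ≤ B := (abs_nonneg _).trans (hρ 0)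
  have h1 : ∀ σ : Fin N → Fin 2, |∏ i, ![ρ, μ₂] (σ i) (t i)| ≤ B ^ N := by
    intro σ
    rw [Finset.abs_prod]
    refine (Finset.prod_le_prod (fun _ _ => abs_nonneg _) (g := fun _ => B) fun i _ => ?_).trans
      (by simp)
    generalize σ i = j
    fin_cases j
    · exact hρ _
    · exact hμ _
  refine (Finset.abs_sum_le_sum_abs _ _).trans ((Finset.sum_le_card_nsmul _ _ _
    fun σ _ => h1 σ).trans ?_)
  rw [nsmul_eq_mul, mul_pow]
  refine mul_le_mul_of_nonneg_right ?_ (by positivity)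
  have : (Finset.univ.filter fun σ : Fin N → Fin 2 => ∑ i, (σ i : ℕ) = m).card ≤ 2 ^ N :=
    (Finset.card_filter_le _ _).trans (by simp)
  exact_mod_cast this

lemma measurable_degreeWeight {ρ μ₂ : ℝ → ℝ} (hρ : Measurable ρ) (hμ : Measurable μ₂) (N m : ℕ) :
    Measurable (degreeWeight ρ μ₂ N m) := by
  refine Finset.measurable_sum _ fun σ _ => Finset.measurable_prod _ fun i _ => ?_
  generalize σ i = j
  fin_cases j
  · exact hρ.comp (measurable_pi_apply i)
  · exact hμ.comp (measurable_pi_apply i)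

namespace AdmissibleCoefficients

open scoped Matrix.Norms.Operator

variable {ρ μ₁ μ₂ : ℝ → ℝ} {S : Set ℝ} {B : ℝ} (h : AdmissibleCoefficients ρ μ₁ μ₂ S B)

lemma systemMatrix_eq (ρ μ₁ μ₂ : ℝ → ℝ) (w κ : ℂ) (y : ℝ) :
    systemMatrix ρ μ₁ μ₂ w κ y = (-Complex.I * ((μ₁ y)⁻¹ : ℝ)) • !![0, 1; 0, 0] +
      (ρ y * (-Complex.I * w) + μ₂ y * (Complex.I * κ)) • lowerUnit := by
  ext i j
  fin_cases i <;> fin_cases j <;> simp [systemMatrix, lowerUnit]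
  ring

/-- The perturbation of the system matrix by increments of the two spectral parameters. -/
lemma systemMatrix_add (ρ μ₁ μ₂ : ℝ → ℝ) (w κ x y : ℂ) :
    systemMatrix ρ μ₁ μ₂ (w + x) (κ + y) = fun s => systemMatrix ρ μ₁ μ₂ w κ s +
      (ρ s * (-Complex.I * x) + μ₂ s * (Complex.I * y)) • lowerUnit := by
  funext s
  rw [systemMatrix_eq, systemMatrix_eq, add_assoc, ← add_smul]
  congr 2
  ring

include h

lemma nonneg : 0 ≤ B := (abs_nonneg _).trans (h.bound_ρ 0)

lemma continuousAt_weight (u v : ℂ) {s : ℝ} (hs : s ∉ S) :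
    ContinuousAt (fun s => (ρ s * u + μ₂ s * v : ℂ)) s :=
  ((Complex.continuous_ofReal.continuousAt.comp (h.continuousAt_ρ s hs)).mul_const u).add
    ((Complex.continuous_ofReal.continuousAt.comp (h.continuousAt_μ₂ s hs)).mul_const v)

lemma norm_weight_le (u v : ℂ) (s : ℝ) : ‖(ρ s * u + μ₂ s * v : ℂ)‖ ≤ B * ‖u‖ + B * ‖v‖ := by
  refine (norm_add_le _ _).trans ?_
  rw [norm_mul, norm_mul, Complex.norm_real, Complex.norm_real]
  exact add_le_add (mul_le_mul_of_nonneg_right (h.bound_ρ s) (norm_nonneg _))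
    (mul_le_mul_of_nonneg_right (h.bound_μ₂ s) (norm_nonneg _))

lemma exists_bound_perturbation (u v : ℂ) :
    ∃ D, ∀ s, ‖(ρ s * u + μ₂ s * v : ℂ) • lowerUnit‖ ≤ D := by
  refine ⟨(B * ‖u‖ + B * ‖v‖) * ‖lowerUnit‖, fun s => (norm_smul_le _ _).trans ?_⟩
  exact mul_le_mul_of_nonneg_right (h.norm_weight_le u v s) (norm_nonneg _)

lemma regulatedOff_perturbation (u v : ℂ) :
    RegulatedOff S fun s => (ρ s * u + μ₂ s * v : ℂ) • lowerUnit where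
  continuousAt s hs := (h.continuousAt_weight u v hs).smul continuousAt_const
  bounded R := by
    obtain ⟨D, hD⟩ := h.exists_bound_perturbation u v
    exact ⟨D, (norm_nonneg _).trans (hD 0), fun s _ => hD s⟩

lemma exists_bound_systemMatrix (w κ : ℂ) : ∃ C, ∀ y, ‖systemMatrix ρ μ₁ μ₂ w κ y‖ ≤ C := by
  obtain ⟨D, hD⟩ := h.exists_bound_perturbation (-Complex.I * w) (Complex.I * κ)
  refine ⟨B * ‖(!![0, 1; 0, 0] : Matrix (Fin 2) (Fin 2) ℂ)‖ + D, fun y => ?_⟩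
  rw [systemMatrix_eq]
  refine (norm_add_le _ _).trans (add_le_add ((norm_smul_le _ _).trans
    (mul_le_mul_of_nonneg_right ?_ (norm_nonneg _))) (hD y))
  rw [norm_mul, norm_neg, Complex.norm_I, one_mul, Complex.norm_real]
  exact h.bound_μ₁_inv y

lemma regulatedOff_systemMatrix (w κ : ℂ) : RegulatedOff S (systemMatrix ρ μ₁ μ₂ w κ) := by
  rw [funext (systemMatrix_eq ρ μ₁ μ₂ w κ)]
  refine RegulatedOff.add ⟨fun y hy => ?_, fun R => ?_⟩ (h.regulatedOff_perturbation _ _)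
  · exact (continuousAt_const.mul (Complex.continuous_ofReal.continuousAt.comp
      (h.continuousAt_μ₁_inv y hy))).smul continuousAt_const
  · refine ⟨B * ‖(!![0, 1; 0, 0] : Matrix (Fin 2) (Fin 2) ℂ)‖,
      mul_nonneg h.nonneg (norm_nonneg _), fun y _ => (norm_smul_le _ _).trans
        (mul_le_mul_of_nonneg_right ?_ (norm_nonneg _))⟩
    rw [norm_mul, norm_neg, Complex.norm_I, one_mul, Complex.norm_real]
    exact h.bound_μ₁_inv y

lemma periodic_systemMatrix (w κ : ℂ) : Function.Periodic (systemMatrix ρ μ₁ μ₂ w κ) 1 :=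
  fun y => by simp only [systemMatrix, h.periodic_ρ y, h.periodic_μ₁ y, h.periodic_μ₂ y]

lemma matricant_eq (w κ : ℂ) (y y₀ : ℝ) : matricant (systemMatrix ρ μ₁ μ₂ w κ) y y₀ =
    propagator (systemMatrix ρ μ₁ μ₂ w κ) y y₀ := by
  obtain ⟨C, hC⟩ := h.exists_bound_systemMatrix w κ
  exact matricant_eq_propagator h.countable (h.regulatedOff_systemMatrix w κ) hC y y₀

lemma summable_peanoTerm (w κ : ℂ) (y y₀ : ℝ) (i j : Fin 2) :
    Summable fun n => peanoTerm (systemMatrix ρ μ₁ μ₂ w κ) y₀ n y i j := by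
  obtain ⟨C, hC⟩ := h.exists_bound_systemMatrix w κ
  exact (hasSum_peanoTerm_apply h.countable (h.regulatedOff_systemMatrix w κ) hC y₀ y i j).summable

lemma matricantM₂_eq (w κ : ℂ) : matricantM₂ ρ μ₁ μ₂ w κ =
    fun y y₀ => propagator (systemMatrix ρ μ₁ μ₂ w κ) y y₀ 0 1 := by
  funext y y₀
  rw [matricantM₂, h.matricant_eq]

lemma continuous_matricantM₂ (w κ : ℂ) :
    Continuous fun p : ℝ × ℝ => matricantM₂ ρ μ₁ μ₂ w κ p.1 p.2 := by
  obtain ⟨C, hC⟩ := h.exists_bound_systemMatrix w κ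
  simp only [h.matricantM₂_eq]
  exact (matrixEntry 0 1).continuous.comp
    (continuous_propagator h.countable (h.regulatedOff_systemMatrix w κ) hC)

lemma exists_bound_matricantM₂ (w κ : ℂ) : ∃ A, 0 ≤ A ∧ ∀ y ∈ Set.Icc (0 : ℝ) 2,
    ∀ s ∈ Set.Icc (0 : ℝ) 1, ‖matricantM₂ ρ μ₁ μ₂ w κ y s‖ ≤ A := by
  obtain ⟨A, hA⟩ := ((isCompact_Icc (a := (0 : ℝ)) (b := 2)).prod
    (isCompact_Icc (a := (0 : ℝ)) (b := 1))).exists_bound_of_continuousOn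
    (h.continuous_matricantM₂ w κ).continuousOn
  have hA' : ∀ y ∈ Set.Icc (0 : ℝ) 2, ∀ s ∈ Set.Icc (0 : ℝ) 1,
      ‖matricantM₂ ρ μ₁ μ₂ w κ y s‖ ≤ A := fun y hy s hs => hA (y, s) ⟨hy, hs⟩
  exact ⟨A, (norm_nonneg _).trans (hA' 0 (by simp) 0 (by simp)), hA'⟩

lemma measurable_ρ : Measurable ρ :=
  measurable_of_countable_discontinuities h.countable h.continuousAt_ρ

lemma measurable_μ₂ : Measurable μ₂ :=
  measurable_of_countable_discontinuities h.countable h.continuousAt_μ₂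

lemma measurable_weighted_cyclicProduct (w κ : ℂ) (N m : ℕ) :
    Measurable fun t : Fin N → ℝ =>
      (degreeWeight ρ μ₂ N m t : ℂ) * cyclicProduct (matricantM₂ ρ μ₁ μ₂ w κ) N t :=
  (Complex.measurable_ofReal.comp (measurable_degreeWeight h.measurable_ρ h.measurable_μ₂ N m)).mul
    (continuous_cyclicProduct (h.continuous_matricantM₂ w κ) N).measurable

lemma exists_bound_weighted_cyclicProduct (w κ : ℂ) : ∃ A, 0 ≤ A ∧ ∀ (N m : ℕ) (t : Fin N → ℝ),
    (∀ i, t i ∈ Set.Icc (0 : ℝ) 1) →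
      ‖(degreeWeight ρ μ₂ N m t : ℂ) * cyclicProduct (matricantM₂ ρ μ₁ μ₂ w κ) N t‖ ≤ A ^ N := by
  obtain ⟨A, hA0, hA⟩ := h.exists_bound_matricantM₂ w κ
  refine ⟨2 * B * A, mul_nonneg (mul_nonneg two_pos.le h.nonneg) hA0, fun N m t ht => ?_⟩
  rw [norm_mul, mul_pow, Complex.norm_real]
  exact mul_le_mul (abs_degreeWeight_le h.bound_ρ h.bound_μ₂ N m t)
    (norm_cyclicProduct_le hA N t ht) (norm_nonneg _)
    (pow_nonneg (mul_nonneg two_pos.le h.nonneg) N)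

lemma integrableOn_derivIntegrand (w κ : ℂ) (n m : ℕ) :
    IntegrableOn (derivIntegrand ρ μ₁ μ₂ w κ n m) (orderedSimplex (n + m)) volume := by
  obtain ⟨A, hA0, hA⟩ := h.exists_bound_weighted_cyclicProduct w κ
  have hsub : orderedSimplex (n + m) ⊆ Set.univ.pi fun _ => Set.Icc (0 : ℝ) 1 :=
    fun t ht i _ => ht.1 i
  have hcube : IntegrableOn (derivIntegrand ρ μ₁ μ₂ w κ n m)
      (Set.univ.pi fun _ => Set.Icc (0 : ℝ) 1) volume := by
    refine Measure.integrableOn_of_bounded (M := A ^ (n + m)) ?_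
      (h.measurable_weighted_cyclicProduct w κ (n + m) m).aestronglyMeasurable ?_
    · exact (isCompact_univ_pi fun _ => isCompact_Icc).measure_lt_top.ne
    · refine (ae_restrict_mem (MeasurableSet.univ_pi fun _ => measurableSet_Icc)).mono
        fun t ht => ?_
      exact hA (n + m) m t fun i => ht i trivial
  exact hcube.mono_set hsub

end AdmissibleCoefficients

/-! ### Taylor expansion of the Lyapunov function -/

lemma degreeWeight_one_zero (ρ μ₂ : ℝ → ℝ) (t : Fin 1 → ℝ) :
    degreeWeight ρ μ₂ 1 0 t = ρ (t 0) := by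
  rw [degreeWeight, Finset.sum_filter, ← (Equiv.funUnique (Fin 1) (Fin 2)).symm.sum_comp]
  simp

lemma degreeWeight_one_one (ρ μ₂ : ℝ → ℝ) (t : Fin 1 → ℝ) :
    degreeWeight ρ μ₂ 1 1 t = μ₂ (t 0) := by
  rw [degreeWeight, Finset.sum_filter, ← (Equiv.funUnique (Fin 1) (Fin 2)).symm.sum_comp]
  simp

lemma cyclicProduct_one (K : ℝ → ℝ → ℂ) (t : Fin 1 → ℝ) :
    cyclicProduct K 1 t = K (t 0 + 1) (t 0) := by
  simp [cyclicProduct]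

lemma matricantM₂_add_one (ρ μ₁ μ₂ : ℝ → ℝ) (w κ : ℂ) (y : ℝ) :
    matricantM₂ ρ μ₁ μ₂ w κ (y + 1) y = Complex.I * monodromym₂ ρ μ₁ μ₂ w κ y := by
  rw [monodromym₂, mul_div_cancel₀ _ Complex.I_ne_zero]

/-- The Taylor coefficients of the Lyapunov function at `(w, κ)`. -/
noncomputable def lyapunovCoeff (ρ μ₁ μ₂ : ℝ → ℝ) (w κ : ℂ) (n m : ℕ) : ℂ :=
  -- The constant term is set separately: the convention for the empty cyclic product would give `1
  -- / 2`.
  if n + m = 0 then lyapunov ρ μ₁ μ₂ w κ else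
    1 / 2 * ((-Complex.I) ^ n * Complex.I ^ m) *
      iteratedSimplexIntegral (n + m) 1 (derivIntegrand ρ μ₁ μ₂ w κ n m)

namespace AdmissibleCoefficients

open scoped Matrix.Norms.Operator

variable {ρ μ₁ μ₂ : ℝ → ℝ} {S : Set ℝ} {B : ℝ} (h : AdmissibleCoefficients ρ μ₁ μ₂ S B)

include h

lemma exists_bound_lyapunovCoeff (w κ : ℂ) : ∃ K A : ℝ, 0 ≤ K ∧ 0 ≤ A ∧ ∀ n m,
    ‖lyapunovCoeff ρ μ₁ μ₂ w κ n m‖ ≤ K * (A ^ (n + m) / (n + m).factorial) := by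
  obtain ⟨A, hA0, hA⟩ := h.exists_bound_weighted_cyclicProduct w κ
  refine ⟨max 1 ‖lyapunov ρ μ₁ μ₂ w κ‖, A, by positivity, hA0, fun n m => ?_⟩
  rw [lyapunovCoeff]
  split_ifs with hnm
  · simp [hnm]
  · have h1 : ‖iteratedSimplexIntegral (n + m) 1 (derivIntegrand ρ μ₁ μ₂ w κ n m)‖ ≤
        A ^ (n + m) * 1 ^ (n + m) / (n + m).factorial :=
      norm_iteratedSimplexIntegral_le (fun t ht => hA (n + m) m t ht) (by simp)
    rw [one_pow, mul_one] at h1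
    rw [norm_mul]
    refine mul_le_mul (le_trans ?_ (le_max_left _ _)) h1 (norm_nonneg _) (by positivity)
    simp
    norm_num

/-- The `N`-th Dyson term is exactly the homogeneous part of degree `N` in the increments. -/
lemma trace_iterate_duhamel (w κ x y : ℂ) {N : ℕ} (hN : N ≠ 0) :
    1 / 2 * ((duhamel (systemMatrix ρ μ₁ μ₂ w κ) fun s =>
      (ρ s * (-Complex.I * x) + μ₂ s * (Complex.I * y) : ℂ) • lowerUnit)^[N]
        (fun s => propagator (systemMatrix ρ μ₁ μ₂ w κ) s 0) 1).trace =
      ∑ p ∈ Finset.HasAntidiagonal.antidiagonal N,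
        lyapunovCoeff ρ μ₁ μ₂ w κ p.1 p.2 * x ^ p.1 * y ^ p.2 := by
  obtain ⟨C, hC⟩ := h.exists_bound_systemMatrix w κ
  obtain ⟨A, -, hA⟩ := h.exists_bound_weighted_cyclicProduct w κ
  have hQ := h.regulatedOff_systemMatrix w κ
  let φ : Matrix (Fin 2) (Fin 2) ℂ →L[ℝ] ℂ :=
    LinearMap.toContinuousLinearMap (Matrix.traceLinearMap (Fin 2) ℝ ℂ)
  have h1 := map_iterate_duhamel h.countable hQ hC
    (h.regulatedOff_perturbation (-Complex.I * x) (Complex.I * y)) φ N 1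
  have h2 : ∀ t : Fin N → ℝ, φ (dysonIntegrand (systemMatrix ρ μ₁ μ₂ w κ) (fun s =>
      (ρ s * (-Complex.I * x) + μ₂ s * (Complex.I * y) : ℂ) • lowerUnit) N 1 t) =
      ∑ p ∈ Finset.HasAntidiagonal.antidiagonal N,
        ((-Complex.I * x) ^ p.1 * (Complex.I * y) ^ p.2) * ((degreeWeight ρ μ₂ N p.2 t : ℂ) *
          cyclicProduct (matricantM₂ ρ μ₁ μ₂ w κ) N t) := by
    intro t
    obtain ⟨N, rfl⟩ := Nat.exists_eq_succ_of_ne_zero hN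
    refine (trace_dysonIntegrand h.countable hQ hC (h.periodic_systemMatrix w κ) (fun s =>
      (ρ s * (-Complex.I * x) + μ₂ s * (Complex.I * y) : ℂ)) N t).trans ?_
    rw [prod_eq_sum_degreeWeight, Finset.sum_mul, h.matricantM₂_eq]
    simp only [mul_assoc]
  replace h1 := h1.trans (congrArg (iteratedSimplexIntegral N 1) (funext h2))
  rw [iteratedSimplexIntegral_sum _ _
    (fun p _ => h.measurable_weighted_cyclicProduct w κ N p.2)
    (fun p _ => ⟨A ^ N, fun t ht => hA N p.2 t ht⟩) (by simp)] at h1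
  refine (congrArg (fun z => 1 / 2 * z) h1).trans ?_
  simp only [Finset.mul_sum]
  refine Finset.sum_congr rfl fun p hp => ?_
  obtain rfl := Finset.HasAntidiagonal.mem_antidiagonal.mp hp
  rw [lyapunovCoeff, if_neg hN, mul_pow, mul_pow]
  change _ = 1 / 2 * ((-Complex.I) ^ p.1 * Complex.I ^ p.2) *
    iteratedSimplexIntegral (p.1 + p.2) 1 (fun t => (degreeWeight ρ μ₂ (p.1 + p.2) p.2 t : ℂ) *
      cyclicProduct (matricantM₂ ρ μ₁ μ₂ w κ) (p.1 + p.2) t) * x ^ p.1 * y ^ p.2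
  ring

/-- Since `n! m! ≤ (n + m)!`, the series is dominated by a product of two exponential series. -/
lemma summable_lyapunovCoeff (w κ x y : ℂ) : Summable fun p : ℕ × ℕ =>
    lyapunovCoeff ρ μ₁ μ₂ w κ p.1 p.2 * x ^ p.1 * y ^ p.2 := by
  obtain ⟨K, A, hK, hA, hc⟩ := h.exists_bound_lyapunovCoeff w κ
  have hs := ((Real.summable_pow_div_factorial (A * ‖x‖)).mul_of_nonneg
    (Real.summable_pow_div_factorial (A * ‖y‖)) (fun n => by positivity)
    (fun n => by positivity)).mul_left K
  refine Summable.of_norm_bounded hs fun p => ?_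
  rw [norm_mul, norm_mul, norm_pow, norm_pow]
  have hf : ((p.1.factorial * p.2.factorial : ℕ) : ℝ) ≤ ((p.1 + p.2).factorial : ℕ) := by
    exact_mod_cast Nat.le_of_dvd (Nat.factorial_pos _)
      (Nat.factorial_mul_factorial_dvd_factorial_add _ _)
  have hf0 : (0 : ℝ) < ((p.1.factorial * p.2.factorial : ℕ) : ℝ) := by
    exact_mod_cast Nat.mul_pos (Nat.factorial_pos _) (Nat.factorial_pos _)
  calc ‖lyapunovCoeff ρ μ₁ μ₂ w κ p.1 p.2‖ * ‖x‖ ^ p.1 * ‖y‖ ^ p.2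
      ≤ K * (A ^ (p.1 + p.2) / (p.1.factorial * p.2.factorial : ℕ)) * ‖x‖ ^ p.1 * ‖y‖ ^ p.2 := by
        gcongr
        exact (hc _ _).trans (by gcongr)
    _ = K * ((A * ‖x‖) ^ p.1 / p.1.factorial * ((A * ‖y‖) ^ p.2 / p.2.factorial)) := by
        push_cast
        rw [mul_pow, mul_pow, pow_add]
        field_simp

/-- The everywhere convergent double Taylor expansion of the Lyapunov function. -/
lemma hasSum_lyapunovCoeff (w κ x y : ℂ) : HasSum (fun p : ℕ × ℕ =>
    lyapunovCoeff ρ μ₁ μ₂ w κ p.1 p.2 * x ^ p.1 * y ^ p.2)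
      (lyapunov ρ μ₁ μ₂ (w + x) (κ + y)) := by
  obtain ⟨C, hC⟩ := h.exists_bound_systemMatrix w κ
  obtain ⟨D, hD⟩ := h.exists_bound_systemMatrix (w + x) (κ + y)
  obtain ⟨E, hE⟩ := h.exists_bound_perturbation (-Complex.I * x) (Complex.I * y)
  rw [systemMatrix_add] at hD
  have hlim := tendsto_sum_iterate_duhamel h.countable (h.regulatedOff_systemMatrix w κ) hC
    (h.regulatedOff_perturbation (-Complex.I * x) (Complex.I * y)) hD hE
  rw [← systemMatrix_add, ← h.matricant_eq] at hlim
  have htr : Continuous fun A : Matrix (Fin 2) (Fin 2) ℂ => 1 / 2 * A.trace :=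
    continuous_const.mul continuous_id.matrix_trace
  have hlim' := (htr.tendsto _).comp hlim
  have hs := (h.summable_lyapunovCoeff w κ x y).hasSum
  have hs' := (hasSum_sum_antidiagonal hs).tendsto_sum_nat
  suffices hval : ∑' p : ℕ × ℕ, lyapunovCoeff ρ μ₁ μ₂ w κ p.1 p.2 * x ^ p.1 * y ^ p.2 =
      lyapunov ρ μ₁ μ₂ (w + x) (κ + y) from hval ▸ hs
  -- Partial sums along antidiagonals are the traced Dyson partial sums, so both limits agree.
  refine tendsto_nhds_unique hs' (hlim'.congr fun N => ?_)
  simp only [Function.comp_apply, Matrix.trace_sum, Finset.mul_sum]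
  refine Finset.sum_congr rfl fun k _ => ?_
  rcases eq_or_ne k 0 with rfl | hk
  · simp [lyapunovCoeff, lyapunov, h.matricant_eq]
  · exact h.trace_iterate_duhamel w κ x y hk

lemma analyticAt_lyapunov (w κ : ℂ) :
    AnalyticAt ℂ (fun p : ℂ × ℂ => lyapunov ρ μ₁ μ₂ p.1 p.2) (w, κ) := by
  obtain ⟨K, A, -, hA, hc⟩ := h.exists_bound_lyapunovCoeff w κ
  exact analyticAt_of_hasSum (fun x y => h.hasSum_lyapunovCoeff w κ x y) hA hc

lemma iteratedDeriv_lyapunov (w κ : ℂ) (n m : ℕ) (hnm : 1 ≤ n + m) :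
    iteratedDeriv n (fun w' => iteratedDeriv m (fun κ' => lyapunov ρ μ₁ μ₂ w' κ') κ) w =
      1 / 2 * ((-Complex.I) ^ n * Complex.I ^ m * (n.factorial : ℂ) * (m.factorial : ℂ)) *
        iteratedSimplexIntegral (n + m) 1 (derivIntegrand ρ μ₁ μ₂ w κ n m) := by
  rw [iteratedDeriv_iteratedDeriv_eq_of_hasSum (fun x y => h.hasSum_lyapunovCoeff w κ x y) n m,
    lyapunovCoeff, if_neg (by omega)]
  ring

lemma continuous_monodromym₂ (w κ : ℂ) : Continuous (monodromym₂ ρ μ₁ μ₂ w κ) :=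
  ((h.continuous_matricantM₂ w κ).comp
    ((continuous_id.add continuous_const).prodMk continuous_id)).div_const _

lemma intervalIntegrable_mul_monodromym₂ (w κ : ℂ) (u v : ℂ) :
    IntervalIntegrable (fun y => (ρ y * u + μ₂ y * v) * monodromym₂ ρ μ₁ μ₂ w κ y) volume 0 1 := by
  have hr : RegulatedOff S fun y => (ρ y * u + μ₂ y * v : ℂ) :=
    ⟨fun y hy => h.continuousAt_weight u v hy, fun _ => ⟨B * ‖u‖ + B * ‖v‖,
      (norm_nonneg _).trans (h.norm_weight_le u v 0), fun y _ => h.norm_weight_le u v y⟩⟩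
  exact (hr.mul (.of_continuous (h.continuous_monodromym₂ w κ))).intervalIntegrable h.countable 0 1

lemma hasDerivAt_lyapunov_fst (w κ : ℂ) : HasDerivAt (fun w' => lyapunov ρ μ₁ μ₂ w' κ)
    (1 / 2 * ∫ y in (0 : ℝ)..1, (ρ y : ℂ) * monodromym₂ ρ μ₁ μ₂ w κ y) w := by
  have hd : DifferentiableAt ℂ (fun w' => lyapunov ρ μ₁ μ₂ w' κ) w :=
    DifferentiableAt.comp (g := fun p : ℂ × ℂ => lyapunov ρ μ₁ μ₂ p.1 p.2) (f := fun w' => (w', κ))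
      w (h.analyticAt_lyapunov w κ).differentiableAt
      (differentiableAt_id.prodMk (differentiableAt_const κ))
  refine hd.hasDerivAt.congr_deriv ?_
  have h1 := h.iteratedDeriv_lyapunov w κ 1 0 le_rfl
  rw [iteratedDeriv_one] at h1
  simp only [iteratedDeriv_zero] at h1
  have h2 : iteratedSimplexIntegral (1 + 0) 1 (derivIntegrand ρ μ₁ μ₂ w κ 1 0) =
      ∫ s in (0 : ℝ)..1, Complex.I * ((ρ s : ℂ) * monodromym₂ ρ μ₁ μ₂ w κ s) := by
    change ∫ s in (0 : ℝ)..1, (degreeWeight ρ μ₂ 1 0 (Fin.cons s ![]) : ℂ) *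
      cyclicProduct (matricantM₂ ρ μ₁ μ₂ w κ) 1 (Fin.cons s ![]) = _
    refine intervalIntegral.integral_congr fun s _ => ?_
    simp only [degreeWeight_one_zero, cyclicProduct_one, Fin.cons_zero, matricantM₂_add_one]
    ring
  rw [h1, h2, intervalIntegral.integral_const_mul]
  -- The prefactor `-i` meets the `i` of `M₂ = i m₂` and gives `1`; for the derivative in `k²` the
  -- product is `i · i = -1`, hence the opposite sign.
  linear_combination (-1 / 2 * ∫ y in (0 : ℝ)..1, (ρ y : ℂ) * monodromym₂ ρ μ₁ μ₂ w κ y) *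
    Complex.I_sq

lemma hasDerivAt_lyapunov_snd (w κ : ℂ) : HasDerivAt (fun κ' => lyapunov ρ μ₁ μ₂ w κ')
    (-(1 / 2) * ∫ y in (0 : ℝ)..1, (μ₂ y : ℂ) * monodromym₂ ρ μ₁ μ₂ w κ y) κ := by
  have hd : DifferentiableAt ℂ (fun κ' => lyapunov ρ μ₁ μ₂ w κ') κ :=
    DifferentiableAt.comp (g := fun p : ℂ × ℂ => lyapunov ρ μ₁ μ₂ p.1 p.2) (f := fun κ' => (w, κ'))
      κ (h.analyticAt_lyapunov w κ).differentiableAt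
      ((differentiableAt_const w).prodMk differentiableAt_id)
  refine hd.hasDerivAt.congr_deriv ?_
  have h1 := h.iteratedDeriv_lyapunov w κ 0 1 le_rfl
  simp only [iteratedDeriv_one, iteratedDeriv_zero] at h1
  have h2 : iteratedSimplexIntegral (0 + 1) 1 (derivIntegrand ρ μ₁ μ₂ w κ 0 1) =
      ∫ s in (0 : ℝ)..1, Complex.I * ((μ₂ s : ℂ) * monodromym₂ ρ μ₁ μ₂ w κ s) := by
    change ∫ s in (0 : ℝ)..1, (degreeWeight ρ μ₂ 1 1 (Fin.cons s ![]) : ℂ) *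
      cyclicProduct (matricantM₂ ρ μ₁ μ₂ w κ) 1 (Fin.cons s ![]) = _
    refine intervalIntegral.integral_congr fun s _ => ?_
    simp only [degreeWeight_one_one, cyclicProduct_one, Fin.cons_zero, matricantM₂_add_one]
    ring
  rw [h1, h2, intervalIntegral.integral_const_mul]
  linear_combination (1 / 2 * ∫ y in (0 : ℝ)..1, (μ₂ y : ℂ) * monodromym₂ ρ μ₁ μ₂ w κ y) *
    Complex.I_sq

end AdmissibleCoefficients

theorem mainTheorem2 (ρ μ₁ μ₂ : ℝ → ℝ)
    (hρ : IsMaterialCoefficient ρ) (hμ₁ : IsMaterialCoefficient μ₁)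
    (hμ₂ : IsMaterialCoefficient μ₂)
    (hμ₁_bdd : ∃ c : ℝ, 0 < c ∧ ∀ y, c ≤ μ₁ y) :
    -- the Peano series defining the matricant converges (absolutely)
    (∀ (w κ : ℂ) (y y₀ : ℝ) (i j : Fin 2),
      Summable fun n => peanoTerm (systemMatrix ρ μ₁ μ₂ w κ) y₀ n y i j) ∧
    -- the Lyapunov function is analytic in both variables, so all partial derivatives exist
    AnalyticOnNhd ℂ (fun p : ℂ × ℂ => lyapunov ρ μ₁ μ₂ p.1 p.2) Set.univ ∧
    -- the formula for the partial derivatives of every order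
    (∀ (w κ : ℂ) (n m : ℕ), 1 ≤ n + m →
      IntegrableOn (derivIntegrand ρ μ₁ μ₂ w κ n m) (orderedSimplex (n + m)) volume ∧
      iteratedDeriv n (fun w' => iteratedDeriv m (fun κ' => lyapunov ρ μ₁ μ₂ w' κ') κ) w =
        1 / 2 * ((-Complex.I) ^ n * Complex.I ^ m * (n.factorial : ℂ) * (m.factorial : ℂ)) *
          iteratedSimplexIntegral (n + m) 1 (derivIntegrand ρ μ₁ μ₂ w κ n m)) ∧
    -- the first-order derivatives
    (∀ w κ : ℂ,
      IntervalIntegrable (fun y => (ρ y : ℂ) * monodromym₂ ρ μ₁ μ₂ w κ y) volume 0 1 ∧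
      IntervalIntegrable (fun y => (μ₂ y : ℂ) * monodromym₂ ρ μ₁ μ₂ w κ y) volume 0 1 ∧
      HasDerivAt (fun w' => lyapunov ρ μ₁ μ₂ w' κ)
        (1 / 2 * ∫ y in (0 : ℝ)..1, (ρ y : ℂ) * monodromym₂ ρ μ₁ μ₂ w κ y) w ∧
      HasDerivAt (fun κ' => lyapunov ρ μ₁ μ₂ w κ')
        (-(1 / 2) * ∫ y in (0 : ℝ)..1, (μ₂ y : ℂ) * monodromym₂ ρ μ₁ μ₂ w κ y) κ) := by
  obtain ⟨S, B, h⟩ := exists_admissibleCoefficients hρ hμ₁ hμ₂ hμ₁_bdd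
  refine ⟨h.summable_peanoTerm, fun p _ => h.analyticAt_lyapunov p.1 p.2, fun w κ n m hnm =>
    ⟨h.integrableOn_derivIntegrand w κ n m, h.iteratedDeriv_lyapunov w κ n m hnm⟩, fun w κ =>
    ⟨?_, ?_, h.hasDerivAt_lyapunov_fst w κ, h.hasDerivAt_lyapunov_snd w κ⟩⟩
  · simpa using h.intervalIntegrable_mul_monodromym₂ w κ 1 0
  · simpa using h.intervalIntegrable_mul_monodromym₂ w κ 0 1
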